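/- Let $n\ge 1$ and let $G=Sp_{2n}(\mathbb C)$ be the simply connected simple algebraic group of type $C_n$, with Cartan matrix $a_{i,j}=\alpha_j(h_i)$ given by $a_{i,i}=2$, $a_{n-1,n}=-2$, $a_{i,j}=-1$ for the other pairs with $|i-j|=1$, and $a_{i,j}=0$ otherwise. The Chevalley generators act on the vector representation with basis $v_1,\dots,v_n,v_{\bar n},\dots,v_{\bar 1}$ by $f_iv_i=v_{i+1}$, $f_iv_{\overline{i+1}}=v_{\bar i}$, $e_iv_{i+1}=v_i$, $e_iv_{\bar i}=v_{\overline{i+1}}$ $(1\le i<n)$, $f_nv_n=v_{\bar n}$, $e_nv_{\bar n}=v_n$, and by zero on the other basis vectors. Let $T$ be the diagonal maximal torus and $U^{+}$, $U^-$ the upper and lower unitriangular subgroups of $G$ with respect to the above ordered basis. Let $\Lambda_1,\dots,\Lambda_n$ be the fundamental weights, $s_1,\dots,s_n$ the simple reflections, $W$ the Weyl group, and $w_0\in W$ its longest element. Put $x_i(a)=\exp(ae_i)$, $y_i(a)=\exp(af_i)$, $\overline{s}_i=x_i(-1)y_i(1)x_i(-1)$, and $\overline w=\overline s_{i_1}\cdots\overline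 s_{i_l}$ for a reduced expression $w=s_{i_1}\cdots s_{i_l}$. For a dominant weight $\mu$ let $\Delta_\mu$ be the regular function on $G$ with $\Delta_\mu(u^-tu^+)=\mu(t)$ for $u^\pm\in U^\pm$, $t\in T$, and for $u,v\in W$ put $\Delta_{u\mu,v\mu}(g)=\Delta_\mu(\overline u^{-1}g\,\overline v)$. For $c=(c^{(j)}_i)_{1\le i,j\le n}\in(\mathbb C^\times)^{n^2}$ set $\mathbf y_i(a)=y_i(a)\alpha_i^\vee(a^{-1})$ and, for the reduced word $\mathbf i_0=(1,2,\dots,n)^n$ of $w_0$, $$\Theta^-_{\mathbf i_0}(c)=\prod_{j=1}^{n}\mathbf y_1(c^{(j)}_1)\,\mathbf y_2(c^{(j)}_2)\cdots\mathbf y_n(c^{(j)}_n),$$ the factors being taken in the order $j=1,2,\dots,n$ from left to right. Put $c^{(j)}_0=1$. Then: (i) For every $k\in\{1,\dots,n-1\}$, $$\Delta_{w_0s_k\Lambda_k,\Lambda_k}(\Theta^-_{\mathbf i_0}(c))=\frac1{c^{(k)}_1}+\sum_{j=1}^{k-1}\frac{c^{(j)}_{k-j}}{c^{(j)}_{k-j+1}}.$$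 (ii) With $C^{(j)}_i=\dfrac{c^{(n-j)}_i}{c^{(n-j+1)}_{i-1}}$ and $\overline C^{(j)}_i=\dfrac{c^{(n-j)}_{i-1}}{c^{(n-j)}_i}$, $$\Delta_{w_0s_n\Lambda_n,\Lambda_n}(\Theta^-_{\mathbf i_0}(c))=\sum C^{(1)}_{u_1}C^{(2)}_{u_2}\cdots C^{(m)}_{u_m}\cdot\overline C^{(l_1-1)}_{l_1}\,\overline C^{(l_2-2)}_{l_2}\cdots\overline C^{(l_k-k)}_{l_k},$$ where the sum is over all $m,k$ with $k+m=n$, $0\le m<n$, and all sequences of integers $1\le u_1<\cdots<u_m\le n$ and $1\le l_1<\cdots<l_k\le n$. -/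

import Mathlib

open scoped Matrix

noncomputable section

namespace TypeC

/-! ### Root datum of type `C_n`

The nodes `1, …, n` of the Dynkin diagram are the elements `0, …, n - 1` of `Fin n`. -/

/-- The node with (one-based) number `k`. -/
def node (n k : ℕ) (h1 : 1 ≤ k) (hn : k ≤ n) : Fin n := ⟨k - 1, by omega⟩

/-- The Cartan matrix `(a_{i,j})` of type `C_n`, with `a_{i,j} = α_j(h_i)`; the simple root with the
last index is the long one. -/
def cartan (n : ℕ) : Matrix (Fin n) (Fin n) ℤ := Matrix.of fun i j =>
  if i = j then 2
  else if (i : ℕ) + 1 = j ∧ (j : ℕ) + 1 = n then -2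
  else if (i : ℕ) + 1 = j ∨ (j : ℕ) + 1 = i then -1
  else 0

/-- The weight lattice `P`. A weight `λ` is given by its coordinates `⟨h_i, λ⟩` with respect to the
fundamental weights. -/
abbrev Weight (n : ℕ) : Type := Fin n → ℤ

/-- The fundamental weight `Λ_i`. -/
def fundWeight {n : ℕ} (i : Fin n) : Weight n := Pi.single i 1

/-- The simple root `α_i`, so that `⟨h_j, α_i⟩ = a_{j,i}`. -/
def simpleRoot {n : ℕ} (i : Fin n) : Weight n := fun j => cartan n j i

theorem proj_simpleRoot {n : ℕ} (i : Fin n) :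
    (LinearMap.proj i : Weight n →ₗ[ℤ] ℤ) (simpleRoot i) = 2 := by
  simp [simpleRoot, cartan]

/-- The simple reflection `λ ↦ λ - ⟨h_i, λ⟩ α_i` of the weight lattice. -/
def reflection {n : ℕ} (i : Fin n) : Weight n ≃ₗ[ℤ] Weight n :=
  Module.reflection (proj_simpleRoot i)

/-- The Weyl group, generated by the simple reflections. -/
def weylGroup (n : ℕ) : Subgroup (Weight n ≃ₗ[ℤ] Weight n) :=
  Subgroup.closure (Set.range reflection)

/-- The simple reflection `s_i` as an element of the Weyl group. -/
def s {n : ℕ} (i : Fin n) : weylGroup n :=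
  ⟨reflection i, Subgroup.subset_closure (Set.mem_range_self i)⟩

/-- `s_{i_1} ⋯ s_{i_l}` is a reduced expression of `w`. -/
def IsReducedWord {n : ℕ} (l : List (Fin n)) (w : weylGroup n) : Prop :=
  (l.map s).prod = w ∧ ∀ l' : List (Fin n), (l'.map s).prod = w → l.length ≤ l'.length

/-- `w` is an element of maximal length of the Weyl group. -/
def IsLongest {n : ℕ} (w : weylGroup n) : Prop :=
  ∃ l, IsReducedWord l w ∧ ∀ (w' : weylGroup n) l', IsReducedWord l' w' → l'.length ≤ l.length

/-- The longest element `w_0` of the Weyl group. -/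
def w₀ (n : ℕ) : weylGroup n := Classical.epsilon IsLongest

/-! ### The vector representation and the group `Sp_{2n}(ℂ)` -/

/-- Indices of the basis of the vector representation: `Sum.inl i` stands for `v_i` and `Sum.inr i`
for `v_{ī}`. -/
abbrev J (n : ℕ) : Type := Fin n ⊕ Fin n

/-- Position in the order `1 < ⋯ < n < n̄ < ⋯ < 1̄`. -/
def rank {n : ℕ} : J n → ℕ
  | Sum.inl i => i
  | Sum.inr i => 2 * n - 1 - i

/-- The weights of the basis vectors: `wt v_i = Λ_i - Λ_{i-1}` and `wt v_{ī} = Λ_{i-1} - Λ_i`,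
where `Λ_0 = 0`. -/
def wt {n : ℕ} : J n → Weight n
  | Sum.inl i => fun k => if k = i then 1 else if (k : ℕ) + 1 = i then -1 else 0
  | Sum.inr i => fun k => if k = i then -1 else if (k : ℕ) + 1 = i then 1 else 0

/-- The Chevalley generator `e_i` on the vector representation:
`e_i v_{i+1} = v_i` and `e_i v_{ī} = v_{\overline{i+1}}` for `i < n`, `e_n v_{n̄} = v_n`, and all the
other basis vectors are sent to `0`. -/
def e {n : ℕ} (i : Fin n) : Matrix (J n) (J n) ℂ := Matrix.of fun r t =>
  match r, t with
  | Sum.inl a, Sum.inl b => if a = i ∧ (b : ℕ) = i + 1 then 1 else 0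
  | Sum.inr a, Sum.inr b => if b = i ∧ (a : ℕ) = i + 1 then 1 else 0
  | Sum.inl a, Sum.inr b => if a = i ∧ b = i ∧ (i : ℕ) + 1 = n then 1 else 0
  | Sum.inr _, Sum.inl _ => 0

/-- The Chevalley generator `f_i` on the vector representation:
`f_i v_i = v_{i+1}` and `f_i v_{\overline{i+1}} = v_{ī}` for `i < n`, `f_n v_n = v_{n̄}`, and all the
other basis vectors are sent to `0`. -/
def f {n : ℕ} (i : Fin n) : Matrix (J n) (J n) ℂ := (e i)ᵀ

/-- The Gram matrix of the symplectic form that the `e_i` and `f_i` leave invariant: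
`ω(v_i, v_{ī}) = (-1)^(i-1) = -ω(v_{ī}, v_i)`. -/
def Ω (n : ℕ) : Matrix (J n) (J n) ℂ := Matrix.of fun r t =>
  match r, t with
  | Sum.inl a, Sum.inr b => if a = b then (-1) ^ (a : ℕ) else 0
  | Sum.inr a, Sum.inl b => if a = b then -(-1) ^ (a : ℕ) else 0
  | Sum.inl _, Sum.inl _ => 0
  | Sum.inr _, Sum.inr _ => 0

/-- The simply connected simple algebraic group of type `C_n`, that is, the symplectic group
`Sp_{2n}(ℂ)` of the form with Gram matrix `Ω`. -/
def G (n : ℕ) : Subgroup (GL (J n) ℂ) where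
  carrier := {g | (g : Matrix (J n) (J n) ℂ)ᵀ * Ω n * (g : Matrix (J n) (J n) ℂ) = Ω n}
  one_mem' := by simp
  mul_mem' := by
    intro a b ha hb
    simp only [Set.mem_ofPred_eq, Units.val_mul, Matrix.transpose_mul] at *
    calc _ = (b : Matrix (J n) (J n) ℂ)ᵀ *
          ((a : Matrix (J n) (J n) ℂ)ᵀ * Ω n * (a : Matrix (J n) (J n) ℂ)) *
          (b : Matrix (J n) (J n) ℂ) := by simp only [Matrix.mul_assoc]
      _ = _ := by rw [ha, hb]
  inv_mem' := by
    intro a ha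
    simp only [Set.mem_ofPred_eq] at *
    have h1 : (a : Matrix (J n) (J n) ℂ) * ((a⁻¹ : GL (J n) ℂ) : Matrix (J n) (J n) ℂ) = 1 := by
      rw [← Units.val_mul, mul_inv_cancel, Units.val_one]
    have h2 : ((a⁻¹ : GL (J n) ℂ) : Matrix (J n) (J n) ℂ)ᵀ * (a : Matrix (J n) (J n) ℂ)ᵀ = 1 := by
      rw [← Matrix.transpose_mul, h1, Matrix.transpose_one]
    calc _ = ((a⁻¹ : GL (J n) ℂ) : Matrix (J n) (J n) ℂ)ᵀ *
          ((a : Matrix (J n) (J n) ℂ)ᵀ * Ω n * (a : Matrix (J n) (J n) ℂ)) *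
          ((a⁻¹ : GL (J n) ℂ) : Matrix (J n) (J n) ℂ) := by rw [ha]
      _ = (((a⁻¹ : GL (J n) ℂ) : Matrix (J n) (J n) ℂ)ᵀ * (a : Matrix (J n) (J n) ℂ)ᵀ) * Ω n *
          ((a : Matrix (J n) (J n) ℂ) * ((a⁻¹ : GL (J n) ℂ) : Matrix (J n) (J n) ℂ)) := by
            simp only [Matrix.mul_assoc]
      _ = _ := by rw [h1, h2, one_mul, mul_one]

/-- The matrix of an element of the group. -/
def mat {n : ℕ} (g : G n) : Matrix (J n) (J n) ℂ := ((g : GL (J n) ℂ) : Matrix (J n) (J n) ℂ)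

theorem exp_of_sq_eq_zero {n : ℕ} (A : Matrix (J n) (J n) ℂ) (h : A * A = 0) :
    NormedSpace.exp A = 1 + A := by
  rw [NormedSpace.exp_eq_tsum ℚ]
  have hz : ∀ k ∉ Finset.range 2, ((k.factorial : ℚ)⁻¹) • A ^ k = 0 := by
    intro k hk
    obtain ⟨m, rfl⟩ : ∃ m, k = m + 2 := ⟨k - 2, by simp at hk; omega⟩
    rw [pow_add, pow_two, h, mul_zero, smul_zero]
  show ∑' k : ℕ, ((k.factorial : ℚ)⁻¹) • A ^ k = _
  rw [tsum_eq_sum hz]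
  simp [Finset.sum_range_succ]

/-- The exponential of an element of the symplectic Lie algebra of square zero. -/
def expUnit {n : ℕ} (A : Matrix (J n) (J n) ℂ) (h : A * A = 0)
    (hA : Aᵀ * Ω n + Ω n * A = 0) : G n :=
  ⟨⟨NormedSpace.exp A, NormedSpace.exp (-A), by
      rw [exp_of_sq_eq_zero A h, exp_of_sq_eq_zero (-A) (by simp [h])]
      simp [mul_add, add_mul, h], by
      rw [exp_of_sq_eq_zero A h, exp_of_sq_eq_zero (-A) (by simp [h])]
      simp [mul_add, add_mul, h]⟩, by
    show (NormedSpace.exp A)ᵀ * Ω n * NormedSpace.exp A = Ω n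
    rw [exp_of_sq_eq_zero A h]
    have h2 : Aᵀ * Ω n = -(Ω n * A) := eq_neg_of_add_eq_zero_left hA
    simp [mul_add, add_mul, h2, Matrix.mul_assoc, h]⟩

theorem e_mul_e {n : ℕ} (i : Fin n) : e i * e i = 0 := by
  ext r t
  rw [Matrix.mul_apply]
  refine Finset.sum_eq_zero fun x _ => ?_
  rcases r with a | a <;> rcases t with b | b <;> rcases x with x | x <;>
    simp only [e, Matrix.of_apply] <;> grind

theorem Ω_mul_inl {n : ℕ} (M : Matrix (J n) (J n) ℂ) (a : Fin n) (t : J n) :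
    (Ω n * M) (Sum.inl a) t = (-1) ^ (a : ℕ) * M (Sum.inr a) t := by
  simp [Ω, Matrix.mul_apply, Fintype.sum_sum_type]

theorem Ω_mul_inr {n : ℕ} (M : Matrix (J n) (J n) ℂ) (a : Fin n) (t : J n) :
    (Ω n * M) (Sum.inr a) t = -(-1) ^ (a : ℕ) * M (Sum.inl a) t := by
  simp [Ω, Matrix.mul_apply, Fintype.sum_sum_type]

theorem mul_Ω_inl {n : ℕ} (M : Matrix (J n) (J n) ℂ) (r : J n) (b : Fin n) :
    (M * Ω n) r (Sum.inl b) = -(-1) ^ (b : ℕ) * M r (Sum.inr b) := by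
  simp [Ω, Matrix.mul_apply, Fintype.sum_sum_type, mul_comm]

theorem mul_Ω_inr {n : ℕ} (M : Matrix (J n) (J n) ℂ) (r : J n) (b : Fin n) :
    (M * Ω n) r (Sum.inr b) = (-1) ^ (b : ℕ) * M r (Sum.inl b) := by
  simp [Ω, Matrix.mul_apply, Fintype.sum_sum_type, mul_comm]

theorem e_mem {n : ℕ} (i : Fin n) : (e i)ᵀ * Ω n + Ω n * e i = 0 := by
  ext r t
  rcases r with a | a <;> rcases t with b | b <;>
    simp only [Matrix.add_apply, Ω_mul_inl, Ω_mul_inr, mul_Ω_inl, mul_Ω_inr, e,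
      Matrix.transpose_apply, Matrix.of_apply, Matrix.zero_apply] <;> grind

theorem f_mul_f {n : ℕ} (i : Fin n) : f i * f i = 0 := by
  rw [f, ← Matrix.transpose_mul, e_mul_e, Matrix.transpose_zero]

theorem f_mem {n : ℕ} (i : Fin n) : (f i)ᵀ * Ω n + Ω n * f i = 0 := by
  ext r t
  rcases r with a | a <;> rcases t with b | b <;>
    simp only [Matrix.add_apply, Ω_mul_inl, Ω_mul_inr, mul_Ω_inl, mul_Ω_inr, e, f,
      Matrix.transpose_apply, Matrix.of_apply, Matrix.zero_apply] <;> grind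

/-- `x_i(a) = exp (a e_i)`. -/
def x {n : ℕ} (i : Fin n) (a : ℂ) : G n :=
  expUnit (a • e i) (by simp [e_mul_e]) (by
    rw [Matrix.transpose_smul, Matrix.smul_mul, Matrix.mul_smul, ← smul_add, e_mem, smul_zero])

/-- `y_i(a) = exp (a f_i)`. -/
def y {n : ℕ} (i : Fin n) (a : ℂ) : G n :=
  expUnit (a • f i) (by simp [f_mul_f]) (by
    rw [Matrix.transpose_smul, Matrix.smul_mul, Matrix.mul_smul, ← smul_add, f_mem, smul_zero])

/-- The value of the weight `λ`, regarded as a character of the maximal torus, at the element with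
coordinates `a`, that is, at `α_1^∨(a_1) ⋯ α_n^∨(a_n)`. -/
def character {n : ℕ} (lam : Weight n) (a : Fin n → ℂˣ) : ℂˣ := ∏ i, a i ^ lam i

theorem character_wt_inl_mul_inr {n : ℕ} (i : Fin n) (a : Fin n → ℂˣ) :
    character (wt (Sum.inl i)) a * character (wt (Sum.inr i)) a = 1 := by
  rw [character, character, ← Finset.prod_mul_distrib]
  refine Finset.prod_eq_one fun k _ => ?_
  rw [← zpow_add]
  simp only [wt]
  split_ifs <;> simp

/-- The element `α_1^∨(a_1) ⋯ α_n^∨(a_n)` of the maximal torus `T`: it multiplies each basis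
vector `v` by the value of the character `wt v`. All elements of `T` are of this form, for unique
`a_1, …, a_n`, since the group is simply connected. -/
def torus {n : ℕ} (a : Fin n → ℂˣ) : G n :=
  ⟨⟨Matrix.diagonal fun j => (character (wt j) a : ℂ),
      Matrix.diagonal fun j => ((character (wt j) a)⁻¹ : ℂˣ), by
        rw [Matrix.diagonal_mul_diagonal, ← Matrix.diagonal_one]; simp, by
        rw [Matrix.diagonal_mul_diagonal, ← Matrix.diagonal_one]; simp⟩, by
    show (Matrix.diagonal fun j => (character (wt j) a : ℂ))ᵀ * Ω n *
      (Matrix.diagonal fun j => (character (wt j) a : ℂ)) = Ω n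
    ext r t
    rw [Matrix.diagonal_transpose, Matrix.mul_diagonal, Matrix.diagonal_mul]
    have h (i : Fin n) : (character (wt (Sum.inl i)) a : ℂ) * character (wt (Sum.inr i)) a = 1 := by
      rw [← Units.val_mul, character_wt_inl_mul_inr, Units.val_one]
    rcases r with i | i <;> rcases t with k | k <;> simp only [Ω, Matrix.of_apply] <;> grind⟩

/-- The coroot `α_i^∨ : ℂˣ → T`. -/
def coroot {n : ℕ} (i : Fin n) (a : ℂˣ) : G n := torus (Pi.mulSingle i a)

/-- The maximal unipotent subgroup `U`: the upper unitriangular elements of the group, for the order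
`1 < ⋯ < n < n̄ < ⋯ < 1̄` of the basis. -/
def IsUpperUnipotent {n : ℕ} (g : G n) : Prop :=
  (∀ r, mat g r r = 1) ∧ ∀ r t, rank t < rank r → mat g r t = 0

/-- The maximal unipotent subgroup `U⁻`: the lower unitriangular elements of the group. -/
def IsLowerUnipotent {n : ℕ} (g : G n) : Prop :=
  (∀ r, mat g r r = 1) ∧ ∀ r t, rank r < rank t → mat g r t = 0

/-- The representative `x_i(-1) y_i(1) x_i(-1)` of `s_i`. -/
def sBar {n : ℕ} (i : Fin n) : G n := x i (-1) * y i 1 * x i (-1)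

/-- The representative of `w` in the group: the product of the representatives of the simple
reflections along a reduced expression of `w`. It does not depend on this expression. -/
def weylRep {n : ℕ} (w : weylGroup n) : G n :=
  ((Classical.epsilon fun l : List (Fin n) => IsReducedWord l w).map sBar).prod

/-! ### Generalized minors -/

/-- Regular functions on the group, a closed subvariety of the affine space of matrices. -/
def IsRegular {n : ℕ} (F : G n → ℂ) : Prop :=
  ∃ p : MvPolynomial (J n × J n) ℂ, ∀ g, F g = MvPolynomial.eval (fun q => mat g q.1 q.2) p

/-- `F` is the regular function on the group with `F (u⁻ t u⁺) = μ(t)` for all `u⁻ ∈ U⁻`, `t ∈ T`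
and `u⁺ ∈ U`. -/
def IsPrincipalMinor {n : ℕ} (mu : Weight n) (F : G n → ℂ) : Prop :=
  IsRegular F ∧ ∀ (u v : G n) (a : Fin n → ℂˣ), IsLowerUnipotent u → IsUpperUnipotent v →
    F (u * torus a * v) = character mu a

/-- The principal minor `Δ_μ`. -/
def principalMinor {n : ℕ} (mu : Weight n) : G n → ℂ := Classical.epsilon (IsPrincipalMinor mu)

/-- The generalized minor `Δ_{γ,δ}` for `γ`, `δ` in the orbit of the dominant weight `μ`: it is
`g ↦ Δ_μ(ū⁻¹ g v̄)` for Weyl group elements with `γ = u μ` and `δ = v μ`. -/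
def generalizedMinor {n : ℕ} (mu gam del : Weight n) (g : G n) : ℂ :=
  let u : weylGroup n := Classical.epsilon fun w => (w : Weight n ≃ₗ[ℤ] Weight n) mu = gam
  let v : weylGroup n := Classical.epsilon fun w => (w : Weight n ≃ₗ[ℤ] Weight n) mu = del
  principalMinor mu ((weylRep u)⁻¹ * g * weylRep v)

/-! ### The parametrization and the monomials -/

/-- `𝐲_i(a) = y_i(a) α_i^∨(a⁻¹)`. -/
def bigY {n : ℕ} (i : Fin n) (a : ℂˣ) : G n := y i a * coroot i a⁻¹

/-- `Θ⁻(c)` for the reduced word `(1, 2, …, n)^n` of `w_0`: the product of the factors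
`𝐲_1(c_1^{(j)}) 𝐲_2(c_2^{(j)}) ⋯ 𝐲_n(c_n^{(j)})` over `j = 1, …, n`, in this order. Here `c i j` is
the variable with lower index `i + 1` and upper index `j + 1`. -/
def Θ {n : ℕ} (c : Fin n → Fin n → ℂˣ) : G n :=
  (List.ofFn fun j => (List.ofFn fun i => bigY i (c i j)).prod).prod

/-- `c_i^{(j)}` with the one-based indices `1 ≤ i, j ≤ n`, and `c_0^{(j)} = 1`. -/
def coord {n : ℕ} (c : Fin n → Fin n → ℂˣ) (i j : ℕ) : ℂ :=
  if h : (1 ≤ i ∧ i ≤ n) ∧ (1 ≤ j ∧ j ≤ n) then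
    (c (node n i h.1.1 h.1.2) (node n j h.2.1 h.2.2) : ℂ)
  else 1

/-- `C_i^{(j)} = c_i^{(n-j)} / c_{i-1}^{(n-j+1)}`. -/
def monC {n : ℕ} (c : Fin n → Fin n → ℂˣ) (i j : ℕ) : ℂ :=
  coord c i (n - j) / coord c (i - 1) (n - j + 1)

/-- `C̄_i^{(j)} = c_{i-1}^{(n-j)} / c_i^{(n-j)}`. -/
def monCbar {n : ℕ} (c : Fin n → Fin n → ℂˣ) (i j : ℕ) : ℂ :=
  coord c (i - 1) (n - j) / coord c i (n - j)

open Classical in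
/-- The sequences `1 ≤ u_1 < u_2 < ⋯ < u_m ≤ n` of integers. -/
def increasing (n m : ℕ) : Finset (Fin m → ℕ) :=
  (Fintype.piFinset fun _ => Finset.Icc 1 n).filter StrictMono

end TypeC

end

open scoped Matrix

noncomputable section

namespace TypeC

/-! The definitions involve several choices: reduced words, Weyl group elements with a prescribed
value on a weight, and the principal minor itself. The proof makes the left-hand sides concrete
minors of the matrix of Θ⁻(c) and then evaluates these minors.

Reduction to minors. The Weyl group acts on the indices 1, …, n, n̄, …, 1̄ by permutations that
commute with the bar. By the exchange condition, the representative along a reduced word is a signed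
permutation matrix whose signs count inversions (`mat_prod_sBar`). A longest element has every
descent, hence is -1 (`w₀_apply`). The leading k × k minor has the values required of Δ_{Λ_k}, and
uniqueness is only needed at elements joined to T by a polynomial curve
(`IsPrincipalMinor.eq_of_joinedToTorus`). A signed minor depends only on its set of rows, and that
set only on the weight (`generalizedMinor_eq`). So Δ_{w₀ s_k Λ_k, Λ_k} is, up to sign, the minor
with columns 1, …, k and rows 1̄, …, the bar of k-1, and the bar of k+1; for k = n the last row is
n.

Evaluation. Each of the n steps of Θ⁻(c) is block lower triangular. Its upper left block is
bidiagonal, its lower left block lives in column n, and its lower right block is the upper triangle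
of the rank one matrix q_{b+1}/q_a. Hence the lower left block of Θ⁻(c) is V R, where R is upper
unitriangular and consists of the n-th rows of the partial products. A triangular change of columns
turns V into a lower unitriangular matrix (`sum_blockCol_mul_upEntry`), so the minor collapses to
one corner entry (`det_of_lowEntry_rows`). For k < n this is a subdiagonal entry, which gives (i).
For k = n the last row is row n of Θ⁻(c). It is a combination of the rows of R with sums over
increasing sequences as coefficients (`sum_increasingSum_mul_tailRow`). The change of columns has
coefficients of the same kind, and pairing the two gives (ii). -/

/-! ### The action of the Weyl group on the basis of the vector representation -/

/-- The involution `i ↔ ī` of the set of indices. -/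
def bar {n : ℕ} (j : J n) : J n := j.swap

/-- The index that follows `i` in the order `1 < ⋯ < n < n̄ < ⋯ < 1̄`. -/
def up {n : ℕ} (i : Fin n) : J n := if h : (i : ℕ) + 1 < n then Sum.inl ⟨i + 1, h⟩ else Sum.inr i

@[simp] theorem bar_bar {n : ℕ} (j : J n) : bar (bar j) = j := by simp [bar]

@[simp] theorem rank_inl {n : ℕ} (i : Fin n) : rank (Sum.inl i) = i := rfl

@[simp] theorem rank_inr {n : ℕ} (i : Fin n) : rank (Sum.inr i) = 2 * n - 1 - i := rfl

theorem rank_lt {n : ℕ} (j : J n) : rank j < 2 * n := by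
  rcases j with i | i <;> simp only [rank_inl, rank_inr] <;> omega

theorem rank_bar {n : ℕ} (j : J n) : rank (bar j) = 2 * n - 1 - rank j := by
  rcases j with i | i <;> simp only [bar, Sum.swap_inl, Sum.swap_inr, rank_inl, rank_inr] <;> omega

theorem rank_up {n : ℕ} (i : Fin n) : rank (up i) = i + 1 := by
  unfold up
  split_ifs with h
  · rfl
  · simp only [rank_inr]; omega

theorem rank_injective {n : ℕ} : Function.Injective (rank : J n → ℕ) := by
  rintro (a | a) (b | b) h <;> simp only [rank_inl, rank_inr] at h
  · rw [Fin.ext h]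
  · omega
  · omega
  · rw [Fin.ext (show (a : ℕ) = b by omega)]

/-- The action of the simple reflection `s_i` on the indices. -/
def reflFun {n : ℕ} (i : Fin n) (j : J n) : J n :=
  if j = Sum.inl i then up i else if j = up i then Sum.inl i
  else if j = bar (up i) then Sum.inr i else if j = Sum.inr i then bar (up i) else j

/-- On ranks s_i is the swap of two neighbours together with its mirror image; for the last node the
two swaps coincide. Questions about the order of indices thereby become linear arithmetic. -/
theorem rank_reflFun {n : ℕ} (i : Fin n) (j : J n) : rank (reflFun i j) =
    if rank j = i then (i : ℕ) + 1 else if rank j = i + 1 then i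
    else if rank j = 2 * n - 2 - i then 2 * n - 1 - i
    else if rank j = 2 * n - 1 - i then 2 * n - 2 - i else rank j := by
  have h1 : j = Sum.inl i ↔ rank j = i := by rw [← rank_injective.eq_iff, rank_inl]
  have h2 : j = up i ↔ rank j = i + 1 := by rw [← rank_injective.eq_iff, rank_up]
  have h3 : j = bar (up i) ↔ rank j = 2 * n - 2 - i := by
    rw [← rank_injective.eq_iff, rank_bar, rank_up]; omega
  have h4 : j = Sum.inr i ↔ rank j = 2 * n - 1 - i := by rw [← rank_injective.eq_iff, rank_inr]
  simp only [reflFun, h1, h2, h3, h4]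
  split_ifs <;> simp only [rank_up, rank_inl, rank_inr, rank_bar] <;> omega

theorem reflFun_involutive {n : ℕ} (i : Fin n) : Function.Involutive (reflFun i) := by
  intro j
  apply rank_injective
  have := rank_lt j
  rw [rank_reflFun, rank_reflFun]
  split_ifs <;> omega

/-- The permutation of the indices that is given by the simple reflection `s_i`. -/
def reflPerm {n : ℕ} (i : Fin n) : Equiv.Perm (J n) := (reflFun_involutive i).toPerm

theorem rank_reflPerm {n : ℕ} (i : Fin n) (j : J n) : rank (reflPerm i j) =
    if rank j = i then (i : ℕ) + 1 else if rank j = i + 1 then i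
    else if rank j = 2 * n - 2 - i then 2 * n - 1 - i
    else if rank j = 2 * n - 1 - i then 2 * n - 2 - i else rank j := rank_reflFun i j

@[simp] theorem reflPerm_inv {n : ℕ} (i : Fin n) : (reflPerm i)⁻¹ = reflPerm i := rfl

@[simp] theorem reflPerm_reflPerm {n : ℕ} (i : Fin n) (j : J n) :
    reflPerm i (reflPerm i j) = j := reflFun_involutive i j

theorem reflPerm_inl {n : ℕ} (i : Fin n) : reflPerm i (Sum.inl i) = up i := by
  apply rank_injective; simp [rank_reflPerm, rank_up]

theorem reflPerm_up {n : ℕ} (i : Fin n) : reflPerm i (up i) = Sum.inl i := by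
  rw [← reflPerm_inl, reflPerm_reflPerm]

theorem reflPerm_bar {n : ℕ} (i : Fin n) (j : J n) : reflPerm i (bar j) = bar (reflPerm i j) := by
  apply rank_injective
  have := rank_lt j
  rw [rank_bar, rank_reflPerm, rank_reflPerm, rank_bar]
  split_ifs <;> omega

/-- A simple reflection changes the order of two indices only if they are interchanged. -/
theorem eq_of_rank_reflPerm_lt {n : ℕ} {i : Fin n} {p q : J n} (h : rank p < rank q)
    (h' : rank (reflPerm i q) < rank (reflPerm i p)) :
    (p = Sum.inl i ∧ q = up i) ∨ (p = bar (up i) ∧ q = Sum.inr i) := by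
  have := rank_lt p
  have := rank_lt q
  simp only [← rank_injective.eq_iff, rank_inl, rank_inr, rank_bar, rank_up]
  rw [rank_reflPerm, rank_reflPerm] at h'
  split_ifs at h' <;> omega

/-- The permutation of the indices that is given by a word in the simple reflections. -/
def wordPerm {n : ℕ} (l : List (Fin n)) : Equiv.Perm (J n) := (l.map reflPerm).prod

@[simp] theorem wordPerm_nil {n : ℕ} : wordPerm ([] : List (Fin n)) = 1 := rfl

@[simp] theorem wordPerm_cons {n : ℕ} (i : Fin n) (l : List (Fin n)) :
    wordPerm (i :: l) = reflPerm i * wordPerm l := by simp [wordPerm]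

theorem wordPerm_append {n : ℕ} (l l' : List (Fin n)) :
    wordPerm (l ++ l') = wordPerm l * wordPerm l' := by simp [wordPerm]

theorem wordPerm_bar {n : ℕ} (l : List (Fin n)) (j : J n) :
    wordPerm l (bar j) = bar (wordPerm l j) := by
  induction l with
  | nil => rfl
  | cons i l ih => simp [ih, reflPerm_bar]

theorem wordPerm_inv_bar {n : ℕ} (l : List (Fin n)) (j : J n) :
    (wordPerm l)⁻¹ (bar j) = bar ((wordPerm l)⁻¹ j) := by
  rw [Equiv.Perm.inv_eq_iff_eq, wordPerm_bar, Equiv.Perm.inv_def, Equiv.apply_symm_apply]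

theorem bar_injective {n : ℕ} : Function.Injective (bar : J n → J n) :=
  Function.LeftInverse.injective bar_bar

theorem bar_inr {n : ℕ} (i : Fin n) : bar (Sum.inr i) = (Sum.inl i : J n) := rfl

theorem bar_inl {n : ℕ} (i : Fin n) : bar (Sum.inl i) = (Sum.inr i : J n) := rfl

/-- Conjugating a reflection by a permutation that commutes with the bar gives the reflection in the
image of its root, here g s_k g⁻¹ = s_i. In the second alternative it is the mirror pair of k, k+1
that is sent to i, i+1. -/
theorem reflPerm_mul_of_map {n : ℕ} {g : Equiv.Perm (J n)} (hg : ∀ j, g (bar j) = bar (g j))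
    {i k : Fin n} (h : (g (Sum.inl k) = Sum.inl i ∧ g (up k) = up i) ∨
      (g (bar (up k)) = Sum.inl i ∧ g (Sum.inr k) = up i)) :
    reflPerm i * g * reflPerm k = g := by
  have key : ∀ j, reflPerm i (g j) = g (reflPerm k j) := by
    intro j
    show reflFun i (g j) = g (reflFun k j)
    have i1 := hg (Sum.inl k)
    have i2 := hg (up k)
    have q : ∀ p r, g p = r → (g j = r ↔ j = p) := fun p r h => by rw [← h, g.injective.eq_iff]
    rw [bar_inl] at i1
    rcases h with ⟨h1, h2⟩ | ⟨h1, h2⟩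
    · rw [h1, bar_inl] at i1
      rw [h2] at i2
      simp only [reflFun, q _ _ h1, q _ _ h2, q _ _ i1, q _ _ i2]
      split_ifs <;> simp only [h1, h2, i1, i2]
    · have i3 : g (up k) = Sum.inr i := bar_injective (by rw [← i2, h1, bar_inr])
      have i4 : g (Sum.inl k) = bar (up i) := bar_injective (by rw [← i1, h2, bar_bar])
      have n1 : Sum.inl k = bar (up k) ↔ Sum.inr k = up k := by
        rw [← bar_inr, bar_injective.eq_iff]
      have n3 : Sum.inl k ≠ up k := by
        rw [← rank_injective.ne_iff, rank_up, rank_inl]; omega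
      have n4 : Sum.inr k ≠ bar (up k) := by
        rw [← bar_inl, bar_injective.ne_iff]; exact n3
      have n5 : Sum.inr k ≠ (Sum.inl k : J n) := by simp
      have n6 : bar (up k) ≠ up k := by
        rw [← rank_injective.ne_iff, rank_bar, rank_up]; omega
      simp only [reflFun, q _ _ h1, q _ _ h2, q _ _ i3, q _ _ i4]
      split_ifs <;> grind
  ext1 j
  simp [key]

/-- The exchange condition. -/
theorem exchange_aux {n : ℕ} (i : Fin n) (l l₀ : List (Fin n))
    (h₀ : rank ((wordPerm l₀)⁻¹ (Sum.inl i)) < rank ((wordPerm l₀)⁻¹ (up i)))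
    (h : rank ((wordPerm (l₀ ++ l))⁻¹ (up i)) < rank ((wordPerm (l₀ ++ l))⁻¹ (Sum.inl i))) :
    ∃ l', l'.length + 1 = l.length ∧
      reflPerm i * wordPerm (l₀ ++ l) = wordPerm (l₀ ++ l') := by
  induction l generalizing l₀ with
  | nil => rw [List.append_nil] at h; omega
  | cons k l ih =>
    have hsplit : l₀ ++ k :: l = (l₀ ++ [k]) ++ l := by simp
    -- The letter to delete is the first one at which the order of w⁻¹(i) and w⁻¹(i+1) flips.
    by_cases h1 : rank ((wordPerm (l₀ ++ [k]))⁻¹ (Sum.inl i)) <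
        rank ((wordPerm (l₀ ++ [k]))⁻¹ (up i))
    · obtain ⟨l', hl, hp⟩ := ih (l₀ ++ [k]) h1 (by rwa [← hsplit])
      exact ⟨k :: l', by simpa using hl, by rw [hsplit, hp]; simp⟩
    · refine ⟨l, rfl, ?_⟩
      have hne : rank ((wordPerm (l₀ ++ [k]))⁻¹ (Sum.inl i)) ≠
          rank ((wordPerm (l₀ ++ [k]))⁻¹ (up i)) := by
        rw [rank_injective.ne_iff, (Equiv.injective _).ne_iff, ← rank_injective.ne_iff, rank_up,
          rank_inl]
        omega
      have h2 := lt_of_le_of_ne (not_lt.mp h1) hne.symm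
      simp only [wordPerm_append, wordPerm_cons, wordPerm_nil, mul_one, mul_inv_rev, reflPerm_inv,
        Equiv.Perm.mul_apply] at h2
      -- Since s_k reverses the order of these two indices, it interchanges exactly them. So the
      -- prefix `l₀` conjugates s_k into s_i, and the two reflections cancel.
      have h3 := reflPerm_mul_of_map (i := i) (wordPerm_bar l₀) (k := k) (by
        rcases eq_of_rank_reflPerm_lt h₀ h2 with ⟨a, b⟩ | ⟨a, b⟩
        · rw [Equiv.Perm.inv_eq_iff_eq] at a b
          exact Or.inl ⟨a.symm, b.symm⟩
        · rw [Equiv.Perm.inv_eq_iff_eq] at a b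
          exact Or.inr ⟨a.symm, b.symm⟩)
      rw [wordPerm_append, wordPerm_append, wordPerm_cons, ← mul_assoc, ← mul_assoc, h3]

theorem exchange {n : ℕ} (i : Fin n) (l : List (Fin n))
    (h : rank ((wordPerm l)⁻¹ (up i)) < rank ((wordPerm l)⁻¹ (Sum.inl i))) :
    ∃ l', l'.length + 1 = l.length ∧ reflPerm i * wordPerm l = wordPerm l' := by
  obtain ⟨l', h1, h2⟩ := exchange_aux i l [] (by simp [rank_up]) (by simpa using h)
  exact ⟨l', h1, by simpa using h2⟩

/-! ### Weights of the basis vectors -/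

theorem wt_bar {n : ℕ} (j : J n) : wt (bar j) = -wt j := by
  rcases j with i | i <;> ext k <;> simp only [bar, Sum.swap_inl, Sum.swap_inr, wt, Pi.neg_apply] <;>
    split_ifs <;> rfl

theorem reflection_apply {n : ℕ} (i : Fin n) (lam : Weight n) :
    reflection i lam = lam - lam i • simpleRoot i := by
  simp [reflection, Module.reflection_apply]

theorem wt_reflPerm {n : ℕ} (i : Fin n) (j : J n) : wt (reflPerm i j) = reflection i (wt j) := by
  have hinl : ∀ a : Fin n, wt (reflPerm i (Sum.inl a)) = reflection i (wt (Sum.inl a)) := by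
    intro a
    show wt (reflFun i _) = _
    rw [reflection_apply]
    ext k
    simp only [reflFun, up, bar, Pi.sub_apply, Pi.smul_apply, smul_eq_mul, simpleRoot, cartan,
      Matrix.of_apply]
    by_cases hi : (i : ℕ) + 1 < n
    · simp only [hi, dite_true, Sum.swap_inl, reduceCtorEq, if_false, Sum.inl.injEq]
      split_ifs <;> simp only [wt] <;> grind
    · simp only [hi, dite_false, Sum.swap_inr, reduceCtorEq, if_false, Sum.inl.injEq]
      split_ifs <;> simp only [wt] <;> grind
  rcases j with a | a
  · exact hinl a
  · rw [← bar_inl, reflPerm_bar, wt_bar, wt_bar, hinl, map_neg]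

theorem wt_wordPerm {n : ℕ} (l : List (Fin n)) (j : J n) :
    wt (wordPerm l j) = ((l.map s).prod : Weight n ≃ₗ[ℤ] Weight n) (wt j) := by
  induction l with
  | nil => rfl
  | cons i l ih => simp [wt_reflPerm, ih, s]

/-- The coordinate of a weight with respect to `wt v_i`. -/
def epsCoord {n : ℕ} (i : Fin n) (lam : Weight n) : ℤ := ∑ k ∈ Finset.Ici i, lam k

/-- With ε_i = wt v_i one has Λ_k = ε_1 + ⋯ + ε_k, so the ε_i-coefficient of a weight collects its
coordinates at all k ≥ i. -/
theorem epsCoord_wt_inl {n : ℕ} (i a : Fin n) :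
    epsCoord i (wt (Sum.inl a)) = if i = a then 1 else 0 := by
  have h : ∀ k : Fin n, wt (Sum.inl a) k =
      (if k = a then 1 else 0) - (if (k : ℕ) + 1 = a then 1 else 0 : ℤ) := by
    intro k; simp only [wt]; split_ifs <;> first | rfl | omega
  simp only [epsCoord, h, Finset.sum_sub_distrib, Finset.sum_ite_eq', Finset.mem_Ici]
  by_cases h0 : (a : ℕ) = 0
  · have : ∀ k : Fin n, ¬ ((k : ℕ) + 1 = a) := by intro k; omega
    simp only [this, if_false, Finset.sum_const_zero, sub_zero, Fin.le_def, Fin.ext_iff]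
    split_ifs <;> first | rfl | omega
  · have : ∀ k : Fin n, ((k : ℕ) + 1 = a) ↔ k = ⟨a - 1, by omega⟩ := by
      intro k; rw [Fin.ext_iff]; simp only; omega
    simp only [this, Finset.sum_ite_eq', Finset.mem_Ici]
    simp only [Fin.le_def, Fin.ext_iff]
    split_ifs <;> first | rfl | omega

theorem epsCoord_neg {n : ℕ} (i : Fin n) (lam : Weight n) :
    epsCoord i (-lam) = -epsCoord i lam := by simp [epsCoord]

theorem epsCoord_wt_inr {n : ℕ} (i a : Fin n) :
    epsCoord i (wt (Sum.inr a)) = if i = a then -1 else 0 := by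
  rw [← bar_inl, wt_bar, epsCoord_neg, epsCoord_wt_inl]
  split_ifs <;> rfl

theorem wt_injective {n : ℕ} : Function.Injective (wt : J n → Weight n) := by
  have h : ∀ (i : Fin n) (p q : J n), wt p = wt q → epsCoord i (wt p) = epsCoord i (wt q) := by
    intro i p q h; rw [h]
  rintro (a | a) (b | b) hw <;> have := h a _ _ hw <;>
    simp only [epsCoord_wt_inl, epsCoord_wt_inr, if_true] at this <;> grind

theorem fundWeight_eq_sum {n : ℕ} (i : Fin n) :
    fundWeight i = ∑ a ∈ Finset.Iic i, wt (Sum.inl a : J n) := by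
  ext k
  rw [Finset.sum_apply]
  have h : ∀ a : Fin n, wt (Sum.inl a) k =
      (if k = a then 1 else 0) - (if (k : ℕ) + 1 = a then 1 else 0 : ℤ) := by
    intro a; simp only [wt]; split_ifs <;> first | rfl | omega
  simp only [h, Finset.sum_sub_distrib, Finset.sum_ite_eq, Finset.mem_Iic, fundWeight]
  by_cases h0 : (k : ℕ) + 1 < n
  · have : ∀ a : Fin n, ((k : ℕ) + 1 = a) ↔ ⟨k + 1, h0⟩ = a := by
      intro a; rw [Fin.ext_iff]
    simp only [this, Finset.sum_ite_eq, Finset.mem_Iic, Pi.single_apply]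
    simp only [Fin.le_def, Fin.ext_iff]
    split_ifs <;> first | rfl | omega
  · have : ∀ a : Fin n, ¬ ((k : ℕ) + 1 = a) := by intro a; omega
    simp only [this, if_false, Finset.sum_const_zero, sub_zero, Fin.le_def, Pi.single_apply,
      Fin.ext_iff]
    split_ifs <;> first | rfl | omega

theorem weight_eq_sum {n : ℕ} (lam : Weight n) : lam = ∑ i, lam i • fundWeight i := by
  ext k
  simp [fundWeight, Finset.sum_apply, Pi.single_apply]

/-- A linear automorphism of the weight lattice is determined by its values at the weights of the
vector representation. -/
theorem linearEquiv_ext_wt {n : ℕ} {g g' : Weight n ≃ₗ[ℤ] Weight n}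
    (h : ∀ i : Fin n, g (wt (Sum.inl i)) = g' (wt (Sum.inl i))) : g = g' := by
  apply LinearEquiv.ext
  intro lam
  rw [weight_eq_sum lam]
  simp only [map_sum, map_smul, fundWeight_eq_sum, h]

/-- The weights of the vector representation span the weight lattice and are distinct. With its
converse below, this lets Weyl group elements be handled as permutations of indices. -/
theorem prod_eq_of_wordPerm_eq {n : ℕ} {l l' : List (Fin n)} (h : wordPerm l = wordPerm l') :
    (l.map s).prod = (l'.map s).prod := by
  apply Subtype.ext
  apply linearEquiv_ext_wt
  intro i
  rw [← wt_wordPerm, ← wt_wordPerm, h]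

theorem wordPerm_eq_of_prod_eq {n : ℕ} {l l' : List (Fin n)}
    (h : (l.map s).prod = (l'.map s).prod) : wordPerm l = wordPerm l' := by
  ext1 j
  apply wt_injective
  rw [wt_wordPerm, wt_wordPerm, h]

/-! ### Reduced words -/

theorem IsReducedWord.tail {n : ℕ} {i : Fin n} {l : List (Fin n)} {w : weylGroup n}
    (h : IsReducedWord (i :: l) w) : IsReducedWord l (l.map s).prod := by
  refine ⟨rfl, fun l' hl' => ?_⟩
  have := h.2 (i :: l') (by rw [← h.1]; simp [hl'])
  simpa using this

/-- In the opposite order, exchange would turn s_i times `l` into a word one letter shorter than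
`l`, hence give a word for w that is two letters shorter than `i :: l`. -/
theorem IsReducedWord.rank_lt {n : ℕ} {i : Fin n} {l : List (Fin n)} {w : weylGroup n}
    (h : IsReducedWord (i :: l) w) :
    rank ((wordPerm l)⁻¹ (Sum.inl i)) < rank ((wordPerm l)⁻¹ (up i)) := by
  by_contra hc
  have hne : rank ((wordPerm l)⁻¹ (up i)) ≠ rank ((wordPerm l)⁻¹ (Sum.inl i)) := by
    rw [rank_injective.ne_iff, (Equiv.injective _).ne_iff, ← rank_injective.ne_iff, rank_up,
      rank_inl]
    omega
  obtain ⟨l', h1, h2⟩ := exchange i l (lt_of_le_of_ne (not_lt.mp hc) hne)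
  have h3 := h.2 l' (by rw [← h.1]; exact prod_eq_of_wordPerm_eq (by rw [← h2, wordPerm_cons]))
  simp only [List.length_cons] at h3
  omega

theorem s_mul_s {n : ℕ} (i : Fin n) : s i * s i = 1 := by
  apply Subtype.ext
  apply LinearEquiv.ext
  intro lam
  show reflection i (reflection i lam) = lam
  exact Module.involutive_reflection (proj_simpleRoot i) lam

theorem exists_word {n : ℕ} (w : weylGroup n) : ∃ l : List (Fin n), (l.map s).prod = w := by
  obtain ⟨w, hw⟩ := w
  induction hw using Subgroup.closure_induction with
  | mem x hx =>
    obtain ⟨i, rfl⟩ := hx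
    exact ⟨[i], by simp [s]⟩
  | one => exact ⟨[], rfl⟩
  | mul x y hx hy ihx ihy =>
    obtain ⟨l, hl⟩ := ihx
    obtain ⟨l', hl'⟩ := ihy
    exact ⟨l ++ l', by rw [List.map_append, List.prod_append, hl, hl']; rfl⟩
  | inv x hx ih =>
    obtain ⟨l, hl⟩ := ih
    refine ⟨l.reverse, ?_⟩
    have : (l.map s).prod⁻¹ = (l.reverse.map s).prod := by
      rw [List.prod_inv_reverse, List.map_map, List.map_reverse]
      congr 2
    rw [← this, hl]
    rfl

theorem exists_isReducedWord {n : ℕ} (w : weylGroup n) :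
    ∃ l : List (Fin n), IsReducedWord l w := by
  classical
  have h : ∃ k, ∃ l : List (Fin n), (l.map s).prod = w ∧ l.length = k := by
    obtain ⟨l, hl⟩ := exists_word w
    exact ⟨_, l, hl, rfl⟩
  obtain ⟨l, hl, hk⟩ := Nat.find_spec h
  exact ⟨l, hl, fun l' hl' => by rw [hk]; exact Nat.find_min' h ⟨l', hl', rfl⟩⟩

/-! ### The longest element -/

theorem exists_isLongest (n : ℕ) : ∃ w : weylGroup n, IsLongest w := by
  -- The reduced length depends only on the permutation of a finite set, so the maximum of `m`
  -- bounds all lengths.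
  let m : Equiv.Perm (J n) → ℕ := fun σ => sInf {k | ∃ l : List (Fin n), wordPerm l = σ ∧ l.length = k}
  let L : Set ℕ := {k | ∃ (w : weylGroup n) (l : List (Fin n)), IsReducedWord l w ∧ l.length = k}
  have hb : BddAbove L := by
    refine ⟨Finset.univ.sup m, ?_⟩
    rintro k ⟨w, l, hl, rfl⟩
    refine le_trans ?_ (Finset.le_sup (f := m) (Finset.mem_univ (wordPerm l)))
    refine le_csInf ⟨_, l, rfl, rfl⟩ ?_
    rintro k ⟨l', h1, rfl⟩
    exact hl.2 l' (by rw [← hl.1]; exact prod_eq_of_wordPerm_eq h1)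
  have hne : L.Nonempty := by
    obtain ⟨l, hl⟩ := exists_isReducedWord (1 : weylGroup n)
    exact ⟨_, 1, l, hl, rfl⟩
  obtain ⟨w, l, hl, hk⟩ := Nat.sSup_mem hne hb
  exact ⟨w, l, hl, fun w' l' hl' => by rw [hk]; exact le_csSup hb ⟨w', l', hl', rfl⟩⟩

theorem det_reflection {n : ℕ} (i : Fin n) :
    LinearMap.det (reflection i : Weight n →ₗ[ℤ] Weight n) = -1 := by
  have h : (reflection i : Weight n →ₗ[ℤ] Weight n) =
      LinearMap.transvection (LinearMap.proj i) (-simpleRoot i) := by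
    ext1 lam
    ext k
    simp [reflection_apply, LinearMap.transvection, sub_eq_add_neg]
  rw [h, LinearMap.transvection.det, map_neg, proj_simpleRoot]
  norm_num

/-- Only the parity is needed: two words for the same element have lengths of equal parity. -/
theorem det_prod_s {n : ℕ} (l : List (Fin n)) :
    LinearMap.det (((l.map s).prod : Weight n ≃ₗ[ℤ] Weight n) : Weight n →ₗ[ℤ] Weight n) =
      (-1) ^ l.length := by
  induction l with
  | nil => simp
  | cons i l ih =>
    have : ((((i :: l).map s).prod : weylGroup n) : Weight n ≃ₗ[ℤ] Weight n) =
      reflection i * (((l.map s).prod : weylGroup n) : Weight n ≃ₗ[ℤ] Weight n) := by simp [s]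
    rw [this]
    have h2 : ((reflection i * (((l.map s).prod : weylGroup n) : Weight n ≃ₗ[ℤ] Weight n) :
      Weight n ≃ₗ[ℤ] Weight n) : Weight n →ₗ[ℤ] Weight n) = (reflection i : Weight n →ₗ[ℤ] Weight n) *
      ((((l.map s).prod : weylGroup n) : Weight n ≃ₗ[ℤ] Weight n) : Weight n →ₗ[ℤ] Weight n) := rfl
    rw [h2, map_mul, det_reflection, ih, List.length_cons, pow_succ']

/-- Multiplication by s_i cannot lengthen w, and parity rules out equal length. So w has a reduced
word beginning with i, and the ascent at the rest of this word is a descent of w. -/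
theorem IsLongest.rank_lt {n : ℕ} {w : weylGroup n} {l : List (Fin n)} (hl : IsReducedWord l w)
    (hmax : ∀ (w' : weylGroup n) l', IsReducedWord l' w' → l'.length ≤ l.length) (i : Fin n) :
    rank ((wordPerm l)⁻¹ (up i)) < rank ((wordPerm l)⁻¹ (Sum.inl i)) := by
  obtain ⟨l', hl'⟩ := exists_isReducedWord (s i * w)
  have h1 := hmax _ _ hl'
  have hp : ((i :: l').map s).prod = w := by
    rw [List.map_cons, List.prod_cons, hl'.1, ← mul_assoc, s_mul_s, one_mul]
  have h2 := hl.2 _ hp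
  have hpar : l'.length ≠ l.length := by
    intro h
    have e1 := det_prod_s (i :: l')
    have e2 := det_prod_s l
    rw [hp] at e1
    rw [hl.1, e1, List.length_cons, h, pow_succ] at e2
    rcases neg_one_pow_eq_or ℤ l.length with h | h <;> rw [h] at e2 <;> norm_num at e2
  rw [List.length_cons] at h2
  have hred : IsReducedWord (i :: l') w :=
    ⟨hp, fun l'' h'' => le_trans (by rw [List.length_cons]; omega) (hl.2 l'' h'')⟩
  have h3 := hred.rank_lt
  have h4 : wordPerm l = wordPerm (i :: l') := wordPerm_eq_of_prod_eq (by rw [hl.1, hp])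
  rw [h4, wordPerm_cons, mul_inv_rev, Equiv.Perm.mul_apply, Equiv.Perm.mul_apply, reflPerm_inv,
    reflPerm_up, reflPerm_inl]
  exact h3

theorem w₀_apply {n : ℕ} (lam : Weight n) : (w₀ n : Weight n ≃ₗ[ℤ] Weight n) lam = -lam := by
  obtain ⟨l, hl, hmax⟩ : IsLongest (w₀ n) := Classical.epsilon_spec (exists_isLongest n)
  have hd := IsLongest.rank_lt hl hmax
  -- The ranks of w⁻¹(1), …, w⁻¹(n), w⁻¹(n̄) decrease strictly. They start at most at 2n - 1, and
  -- the n-th is at least n because it exceeds its mirror image. This leaves only the mirror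
  -- position for each.
  have hup : ∀ k (hk : k < n), rank ((wordPerm l)⁻¹ (Sum.inl ⟨k, hk⟩)) + k ≤ 2 * n - 1 := by
    intro k
    induction k with
    | zero => intro hk; have := TypeC.rank_lt ((wordPerm l)⁻¹ (Sum.inl ⟨0, hk⟩)); omega
    | succ k ih =>
      intro hk
      have h1 := ih (by omega)
      have h2 := hd ⟨k, by omega⟩
      simp only [up, hk, dite_true] at h2
      omega
  have hlow : ∀ m k (hk : k < n), k + 1 + m = n →
      n + m ≤ rank ((wordPerm l)⁻¹ (Sum.inl ⟨k, hk⟩)) := by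
    intro m
    induction m with
    | zero =>
      intro k hk hkm
      have h2 := hd ⟨k, hk⟩
      have h3 : up ⟨k, hk⟩ = (Sum.inr ⟨k, hk⟩ : J n) := by
        simp only [up]; rw [dif_neg (by omega)]
      rw [h3, ← bar_inl, wordPerm_inv_bar, rank_bar] at h2
      omega
    | succ m ih =>
      intro k hk hkm
      have h1 := ih (k + 1) (by omega) (by omega)
      have h2 := hd ⟨k, hk⟩
      simp only [up, show k + 1 < n by omega, dite_true] at h2
      omega
  have hw : ∀ i : Fin n, wordPerm l (Sum.inl i) = Sum.inr i := by
    intro i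
    have : (wordPerm l)⁻¹ (Sum.inl i) = bar (Sum.inl i) := by
      apply rank_injective
      rw [rank_bar, rank_inl]
      have h1 := hup i i.2
      have h2 := hlow (n - 1 - i) i i.2 (by omega)
      simp only [Fin.eta] at h1 h2
      omega
    rw [Equiv.Perm.inv_eq_iff_eq, wordPerm_bar] at this
    rw [← bar_bar (wordPerm l _), ← this, bar_inl]
  have : (w₀ n : Weight n ≃ₗ[ℤ] Weight n) = LinearEquiv.neg ℤ := by
    apply linearEquiv_ext_wt
    intro i
    rw [← hl.1, ← wt_wordPerm, hw, ← bar_inl, wt_bar]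
    rfl
  rw [this]
  rfl

/-! ### The representatives of the Weyl group elements -/

@[simp] theorem mat_mul {n : ℕ} (g h : G n) : mat (g * h) = mat g * mat h := rfl

@[simp] theorem mat_one {n : ℕ} : mat (1 : G n) = 1 := rfl

theorem mat_injective {n : ℕ} : Function.Injective (mat : G n → _) := fun _ _ h =>
  Subtype.ext (Units.ext h)

theorem mat_x {n : ℕ} (i : Fin n) (a : ℂ) : mat (x i a) = 1 + a • e i :=
  exp_of_sq_eq_zero _ (by simp [e_mul_e])

theorem mat_y {n : ℕ} (i : Fin n) (a : ℂ) : mat (y i a) = 1 + a • f i :=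
  exp_of_sq_eq_zero _ (by simp [f_mul_f])

theorem e_apply {n : ℕ} (i : Fin n) (r t : J n) : e i r t =
    if (r = Sum.inl i ∧ t = up i) ∨ (r = bar (up i) ∧ t = Sum.inr i) then 1 else 0 := by
  unfold e up bar
  by_cases hi : (i : ℕ) + 1 < n
  · rcases r with a | a <;> rcases t with b | b <;> simp [hi, Fin.ext_iff] <;> grind
  · rcases r with a | a <;> rcases t with b | b <;> simp [hi, Fin.ext_iff] <;> grind

theorem e_mul_f {n : ℕ} (i : Fin n) : e i * f i =
    Matrix.diagonal fun j => if j = Sum.inl i ∨ j = bar (up i) then 1 else 0 := by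
  have n3 : Sum.inl i ≠ up i := by
    rw [← rank_injective.ne_iff, rank_up, rank_inl]; omega
  have n1 : Sum.inl i = bar (up i) ↔ Sum.inr i = up i := by
    rw [← bar_inr, bar_injective.eq_iff]
  ext r t
  have h : ∀ k, e i r k * e i t k =
      if r = t ∧ ((r = Sum.inl i ∧ k = up i) ∨ (r = bar (up i) ∧ k = Sum.inr i)) then 1 else 0 := by
    intro k
    simp only [e_apply]
    grind
  simp only [Matrix.mul_apply, f, Matrix.transpose_apply, h, Matrix.diagonal_apply]
  by_cases hrt : r = t
  · subst hrt
    by_cases h1 : r = Sum.inl i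
    · subst h1
      rw [Finset.sum_eq_single (up i)] <;> grind
    · by_cases h2 : r = bar (up i)
      · subst h2
        rw [Finset.sum_eq_single (Sum.inr i)] <;> grind
      · simp [h1, h2]
  · simp [hrt]

theorem f_mul_e {n : ℕ} (i : Fin n) : f i * e i =
    Matrix.diagonal fun j => if j = up i ∨ j = Sum.inr i then 1 else 0 := by
  have n3 : Sum.inl i ≠ up i := by
    rw [← rank_injective.ne_iff, rank_up, rank_inl]; omega
  have n1 : Sum.inl i = bar (up i) ↔ Sum.inr i = up i := by
    rw [← bar_inr, bar_injective.eq_iff]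
  ext r t
  have h : ∀ k, e i k r * e i k t =
      if r = t ∧ ((k = Sum.inl i ∧ r = up i) ∨ (k = bar (up i) ∧ r = Sum.inr i)) then 1 else 0 := by
    intro k
    simp only [e_apply]
    grind
  simp only [Matrix.mul_apply, f, Matrix.transpose_apply, h, Matrix.diagonal_apply]
  by_cases hrt : r = t
  · subst hrt
    by_cases h1 : r = up i
    · subst h1
      rw [Finset.sum_eq_single (Sum.inl i)] <;> grind
    · by_cases h2 : r = Sum.inr i
      · subst h2
        rw [Finset.sum_eq_single (bar (up i))] <;> grind
      · simp [h1, h2]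
  · simp [hrt]

/-- The sign with which the representative of `s_i` moves the basis vector `v_j`. -/
def reflSign {n : ℕ} (i : Fin n) (j : J n) : ℂ := if j = up i ∨ j = Sum.inr i then -1 else 1

theorem mat_sBar {n : ℕ} (i : Fin n) (r t : J n) :
    mat (sBar i) r t = if r = reflPerm i t then reflSign i t else 0 := by
  -- With e² = 0 and efe = e the product (1 - e)(1 + f)(1 - e) collapses to 1 + f - e - ef - fe,
  -- where 1 - ef - fe projects onto the vectors that s_i fixes.
  have hefe : e i * f i * e i = e i := by
    rw [e_mul_f]
    ext r t
    rw [Matrix.diagonal_mul, e_apply]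
    split_ifs <;> grind
  have hm : mat (sBar i) = 1 + f i - e i - e i * f i - f i * e i := by
    simp only [sBar, mat_mul, mat_x, mat_y, neg_smul, one_smul, mul_add, add_mul, mul_one, one_mul,
      neg_mul, mul_neg, e_mul_e, mul_assoc]
    simp only [← mul_assoc, hefe]
    abel
  have n3 : Sum.inl i ≠ up i := by
    rw [← rank_injective.ne_iff, rank_up, rank_inl]; omega
  have n4 : Sum.inr i ≠ bar (up i) := by
    rw [← bar_inl, bar_injective.ne_iff]; exact n3
  have n1 : Sum.inl i = bar (up i) ↔ Sum.inr i = up i := by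
    rw [← bar_inr, bar_injective.eq_iff]
  have n6 : bar (up i) ≠ up i := by
    rw [← rank_injective.ne_iff, rank_bar, rank_up]; omega
  have n5 : Sum.inr i ≠ (Sum.inl i : J n) := by simp
  show _ = if r = reflFun i t then _ else _
  rw [hm, e_mul_f, f_mul_e]
  simp only [Matrix.sub_apply, Matrix.add_apply, Matrix.one_apply, Matrix.diagonal_apply, f,
    Matrix.transpose_apply, e_apply, reflSign, reflFun]
  by_cases t1 : t = Sum.inl i
  · subst t1; grind
  by_cases t2 : t = up i
  · subst t2; grind
  by_cases t3 : t = bar (up i)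
  · subst t3; grind
  by_cases t4 : t = Sum.inr i
  · subst t4; grind
  by_cases hr : r = t
  · subst hr; simp [t1, t2, t3, t4]
  · simp [t1, t2, t3, t4, hr]

/-- The sign of the position of two indices. -/
def ordSign {n : ℕ} (p q : J n) : ℂ := if rank q < rank p then -1 else 1

/-- The sign with which the representative of `w` moves the basis vector `v_a`. -/
def permSign {n : ℕ} (w : Equiv.Perm (J n)) (a : J n) : ℂ :=
  ∏ b, if rank b < rank a then ordSign (w b) (w a) else 1

/-- Only the pair i, i+1 and its mirror image change their relative order under s_i. By `h` both
pairs occur in increasing order in w, so one new inversion appears precisely when w a is the larger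
member of such a pair. -/
theorem permSign_reflPerm_mul {n : ℕ} {i : Fin n} {w : Equiv.Perm (J n)}
    (hw : ∀ j, w (bar j) = bar (w j))
    (h : rank (w⁻¹ (Sum.inl i)) < rank (w⁻¹ (up i))) (a : J n) :
    permSign (reflPerm i * w) a = reflSign i (w a) * permSign w a := by
  have h' : rank (w⁻¹ (bar (up i))) < rank (w⁻¹ (Sum.inr i)) := by
    have hb : ∀ j, w⁻¹ (bar j) = bar (w⁻¹ j) := fun j => by
      rw [Equiv.Perm.inv_eq_iff_eq, hw, Equiv.Perm.inv_def, Equiv.apply_symm_apply]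
    have := TypeC.rank_lt (w⁻¹ (up i))
    rw [← bar_inl, hb, hb, rank_bar, rank_bar]
    omega
  have key : ∀ b, (if rank b < rank a then ordSign ((reflPerm i * w) b) ((reflPerm i * w) a) else 1) =
      (if (w a = up i ∧ w b = Sum.inl i) ∨ (w a = Sum.inr i ∧ w b = bar (up i)) then -1 else 1) *
        if rank b < rank a then ordSign (w b) (w a) else 1 := by
    intro b
    have hb1 : w⁻¹ (w b) = b := by simp
    have ha1 : w⁻¹ (w a) = a := by simp
    show (if rank b < rank a then ordSign (reflPerm i (w b)) (reflPerm i (w a)) else 1) = _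
    unfold ordSign
    by_cases h1 : w a = up i ∧ w b = Sum.inl i
    · have : rank b < rank a := by rw [← hb1, ← ha1, h1.1, h1.2]; exact h
      simp only [h1, this, reflPerm_inl, reflPerm_up, rank_inl, rank_up]
      simp
    by_cases h2 : w a = Sum.inr i ∧ w b = bar (up i)
    · have : rank b < rank a := by rw [← hb1, ← ha1, h2.1, h2.2]; exact h'
      have e1 : rank (bar (up i)) < rank (Sum.inr i : J n) := by
        rw [rank_bar, rank_up, rank_inr]; omega
      have e2 : reflPerm i (Sum.inr i) = bar (up i) := by rw [← bar_inl, reflPerm_bar, reflPerm_inl]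
      have e3 : reflPerm i (bar (up i)) = Sum.inr i := by rw [← e2, reflPerm_reflPerm]
      simp only [h2, this, e2, e3, e1, e1.not_gt]
      simp
    simp only [h1, h2, or_self, if_false, one_mul]
    by_cases hba : rank b < rank a
    · simp only [hba, if_true]
      have hne : w b ≠ w a := fun hh => by rw [w.injective hh] at hba; exact lt_irrefl _ hba
      by_cases h3 : rank (w a) < rank (w b)
      · rw [if_pos h3, if_pos]
        by_contra h4
        rcases eq_of_rank_reflPerm_lt (i := i) h3 (lt_of_le_of_ne (not_lt.mp h4) (by
          rw [rank_injective.ne_iff, (Equiv.injective _).ne_iff]; exact hne)) with hh | hh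
        · rw [← hh.1, ← hh.2, ha1, hb1] at h; omega
        · rw [← hh.1, ← hh.2, ha1, hb1] at h'; omega
      · rw [if_neg h3, if_neg]
        intro h4
        rcases eq_of_rank_reflPerm_lt (lt_of_le_of_ne (not_lt.mp h3) (by
          rw [rank_injective.ne_iff]; exact hne)) h4 with hh | hh
        · exact h1 hh.symm
        · exact h2 hh.symm
    · simp only [hba, if_false]
  simp only [permSign, key, Finset.prod_mul_distrib]
  congr 1
  have n3 : Sum.inl i ≠ up i := by
    rw [← rank_injective.ne_iff, rank_up, rank_inl]; omega
  have n1 : Sum.inl i = bar (up i) ↔ Sum.inr i = up i := by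
    rw [← bar_inr, bar_injective.eq_iff]
  unfold reflSign
  by_cases h1 : w a = up i
  · rw [Finset.prod_eq_single (w⁻¹ (Sum.inl i))]
    · simp [h1]
    · intro b _ hb
      rw [Ne, Equiv.Perm.eq_inv_iff_eq] at hb
      rw [if_neg]
      grind
    · simp
  by_cases h2 : w a = Sum.inr i
  · rw [Finset.prod_eq_single (w⁻¹ (bar (up i)))]
    · simp [h2]
    · intro b _ hb
      rw [Ne, Equiv.Perm.eq_inv_iff_eq] at hb
      rw [if_neg]
      grind
    · simp
  simp [h1, h2]

/-- The right-hand side involves the word only through its permutation, so the choice of a reduced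
expression is immaterial. -/
theorem mat_prod_sBar {n : ℕ} {l : List (Fin n)} {w : weylGroup n} (hl : IsReducedWord l w)
    (r t : J n) : mat (l.map sBar).prod r t =
      if r = wordPerm l t then permSign (wordPerm l) t else 0 := by
  induction l generalizing r w with
  | nil =>
    have : permSign (1 : Equiv.Perm (J n)) t = 1 := by
      refine Finset.prod_eq_one fun b _ => ?_
      show (if rank b < rank t then ordSign b t else 1) = 1
      unfold ordSign
      split_ifs <;> first | rfl | omega
    simp [this, Matrix.one_apply]
  | cons i l ih =>
    rw [List.map_cons, List.prod_cons, mat_mul, Matrix.mul_apply]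
    simp only [mat_sBar, ih hl.tail, wordPerm_cons,
      permSign_reflPerm_mul (wordPerm_bar l) hl.rank_lt, mul_ite, mul_zero, Finset.sum_ite_eq',
      Finset.mem_univ, if_true, Equiv.Perm.mul_apply]
    split_ifs <;> simp

theorem permSign_mul_self {n : ℕ} (w : Equiv.Perm (J n)) (a : J n) :
    permSign w a * permSign w a = 1 := by
  rw [permSign, ← Finset.prod_mul_distrib]
  refine Finset.prod_eq_one fun b _ => ?_
  simp only [ordSign]
  split_ifs <;> norm_num

/-! ### Minors with rows in an arbitrary order -/

/-- The sign of the permutation that sorts a sequence of indices. -/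
def seqSign {n k : ℕ} (ρ : Fin k → J n) : ℂ := ∏ a, ∏ b ∈ Finset.Iio a, ordSign (ρ b) (ρ a)

theorem seqSign_comp {n k : ℕ} {ρ : Fin k → J n} (hρ : Function.Injective ρ)
    (τ : Equiv.Perm (Fin k)) : seqSign (ρ ∘ τ) = (Equiv.Perm.sign τ : ℤ) * seqSign ρ := by
  -- Setting the diagonal to zero makes `F` antisymmetric everywhere, as the product formula for the
  -- sign requires.
  let F : Fin k → Fin k → ℂ := fun a b => if a = b then 0 else ordSign (ρ a) (ρ b)
  have hF : ∀ a b, F a b = -F b a := by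
    intro a b
    simp only [F, ordSign]
    by_cases hab : a = b
    · simp [hab]
    · have : rank (ρ a) ≠ rank (ρ b) := by
        rw [rank_injective.ne_iff, hρ.ne_iff]; exact hab
      simp only [hab, Ne.symm hab, if_false]
      split_ifs <;> first | omega | simp
  have h := τ.prod_Iio_comp_eq_sign_mul_prod hF
  have h1 : seqSign (ρ ∘ τ) = ∏ j, ∏ i ∈ Finset.Iio j, F (τ i) (τ j) := by
    refine Finset.prod_congr rfl fun a _ => Finset.prod_congr rfl fun b hb => ?_
    rw [Finset.mem_Iio] at hb
    simp only [F, τ.injective.eq_iff, hb.ne, if_false, Function.comp]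
  have h2 : seqSign ρ = ∏ j, ∏ i ∈ Finset.Iio j, F i j := by
    refine Finset.prod_congr rfl fun a _ => Finset.prod_congr rfl fun b hb => ?_
    rw [Finset.mem_Iio] at hb
    simp only [F, hb.ne, if_false]
  rw [h1, h2, h]

theorem exists_perm_of_range_eq {α : Type*} {k : ℕ} {ρ ρ' : Fin k → α}
    (hρ' : Function.Injective ρ') (h : Set.range ρ = Set.range ρ') :
    ∃ τ : Equiv.Perm (Fin k), ρ' = ρ ∘ τ := by
  have : ∀ a, ∃ b, ρ b = ρ' a := fun a => by
    have : ρ' a ∈ Set.range ρ := by rw [h]; exact Set.mem_range_self a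
    exact this
  choose τ hτ using this
  have hinj : Function.Injective τ := fun a b hab => hρ' (by rw [← hτ, ← hτ, hab])
  exact ⟨Equiv.ofBijective τ (Finite.injective_iff_bijective.mp hinj), funext fun a => (hτ a).symm⟩

/-- The signed minor depends only on the set of rows. -/
theorem seqSign_mul_det_rows {n k : ℕ} (M : Matrix (J n) (J n) ℂ) {ρ ρ' : Fin k → J n}
    (σ : Fin k → J n) (hρ : Function.Injective ρ) (hρ' : Function.Injective ρ')
    (h : Set.range ρ = Set.range ρ') :
    seqSign ρ' * (M.submatrix ρ' σ).det = seqSign ρ * (M.submatrix ρ σ).det := by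
  obtain ⟨τ, rfl⟩ := exists_perm_of_range_eq hρ' h
  have h1 : M.submatrix (ρ ∘ τ) σ = (M.submatrix ρ σ).submatrix τ id := rfl
  rw [seqSign_comp hρ, h1, Matrix.det_permute]
  have h2 : ((Equiv.Perm.sign τ : ℤ) : ℂ) * ((Equiv.Perm.sign τ : ℤ) : ℂ) = 1 := by
    rw [← Int.cast_mul, ← Units.val_mul, Int.units_mul_self]; simp
  linear_combination (seqSign ρ * (M.submatrix ρ σ).det) * h2

theorem seqSign_mul_det_cols {n k : ℕ} (M : Matrix (J n) (J n) ℂ) {σ σ' : Fin k → J n}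
    (ρ : Fin k → J n) (hσ : Function.Injective σ) (hσ' : Function.Injective σ')
    (h : Set.range σ = Set.range σ') :
    seqSign σ' * (M.submatrix ρ σ').det = seqSign σ * (M.submatrix ρ σ).det := by
  have := seqSign_mul_det_rows Mᵀ ρ hσ hσ' h
  rw [← Matrix.det_transpose, ← Matrix.det_transpose (M.submatrix ρ σ)]
  exact this

/-- The sequence of the first `k` indices. -/
def emb {n k : ℕ} (hk : k ≤ n) (a : Fin k) : J n := Sum.inl (Fin.castLE hk a)

theorem rank_emb {n k : ℕ} (hk : k ≤ n) (a : Fin k) : rank (emb hk a) = a := rfl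

theorem emb_injective {n k : ℕ} (hk : k ≤ n) : Function.Injective (emb hk) := by
  intro a b h
  simpa [emb] using h

/-- The indices of smaller rank than the a-th one are exactly the earlier members of the sequence,
so only inversions inside the sequence are counted. -/
theorem permSign_emb {n k : ℕ} (hk : k ≤ n) (w : Equiv.Perm (J n)) (a : Fin k) :
    permSign w (emb hk a) = ∏ b ∈ Finset.Iio a, ordSign (w (emb hk b)) (w (emb hk a)) := by
  rw [permSign, ← Finset.prod_filter]
  have : (Finset.univ.filter fun b : J n => rank b < rank (emb hk a)) =
      (Finset.Iio a).map ⟨emb hk, emb_injective hk⟩ := by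
    ext b
    rw [Finset.mem_filter, rank_emb]
    simp only [Finset.mem_univ, true_and, Finset.mem_map, Finset.mem_Iio,
      Function.Embedding.coeFn_mk]
    constructor
    · intro hb
      refine ⟨⟨rank b, by omega⟩, hb, rank_injective rfl⟩
    · rintro ⟨c, hc, rfl⟩
      exact hc
  rw [this, Finset.prod_map]
  rfl

theorem prod_permSign_emb {n k : ℕ} (hk : k ≤ n) (w : Equiv.Perm (J n)) :
    ∏ a, permSign w (emb hk a) = seqSign (w ∘ emb hk) :=
  Finset.prod_congr rfl fun a _ => permSign_emb hk w a

theorem seqSign_emb {n k : ℕ} (hk : k ≤ n) : seqSign (emb hk) = 1 := by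
  refine Finset.prod_eq_one fun a _ => Finset.prod_eq_one fun b hb => ?_
  rw [Finset.mem_Iio, Fin.lt_def] at hb
  rw [ordSign, rank_emb, rank_emb, if_neg (by omega)]

/-- The leading principal minor of size `k`. -/
def leadingMinor {n k : ℕ} (hk : k ≤ n) (M : Matrix (J n) (J n) ℂ) : ℂ :=
  (M.submatrix (emb hk) (emb hk)).det

/-- The representatives are signed permutation matrices: they permute rows and columns, and the
signs pulled out of the determinant multiply to the two sorting signs. -/
theorem leadingMinor_conj {n k : ℕ} (hk : k ≤ n) {l l' : List (Fin n)} {w w' : weylGroup n}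
    (hl : IsReducedWord l w) (hl' : IsReducedWord l' w') (g : G n) :
    leadingMinor hk (mat ((l.map sBar).prod⁻¹ * g * (l'.map sBar).prod)) =
      seqSign (wordPerm l ∘ emb hk) * (seqSign (wordPerm l' ∘ emb hk) *
        ((mat g).submatrix (wordPerm l ∘ emb hk) (wordPerm l' ∘ emb hk)).det) := by
  have h1 : ∀ (A : G n) r t, mat ((l.map sBar).prod⁻¹ * A) r t =
      permSign (wordPerm l) r * mat A (wordPerm l r) t := by
    intro A r t
    have h2 : mat A (wordPerm l r) t = permSign (wordPerm l) r * mat ((l.map sBar).prod⁻¹ * A) r t := by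
      conv_lhs => rw [← mul_inv_cancel_left (l.map sBar).prod A]
      rw [mat_mul, Matrix.mul_apply]
      simp only [mat_prod_sBar hl, (Equiv.injective _).eq_iff, ite_mul, zero_mul,
        Finset.sum_ite_eq, Finset.mem_univ, if_true]
    rw [h2, ← mul_assoc, permSign_mul_self, one_mul]
  have h3 : ∀ (A : G n) r t, mat (A * (l'.map sBar).prod) r t =
      permSign (wordPerm l') t * mat A r (wordPerm l' t) := by
    intro A r t
    rw [mat_mul, Matrix.mul_apply]
    simp only [mat_prod_sBar hl', mul_ite, mul_zero, Finset.sum_ite_eq', Finset.mem_univ, if_true]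
    rw [mul_comm]
  have h4 : (mat ((l.map sBar).prod⁻¹ * g * (l'.map sBar).prod)).submatrix (emb hk) (emb hk) =
      Matrix.of fun a b => permSign (wordPerm l) (emb hk a) *
        (Matrix.of fun a b => permSign (wordPerm l') (emb hk b) *
          (mat g).submatrix (wordPerm l ∘ emb hk) (wordPerm l' ∘ emb hk) a b) a b := by
    ext a b
    simp only [Matrix.submatrix_apply, h3, h1, Matrix.of_apply, Function.comp]
    ring
  rw [leadingMinor, h4, Matrix.det_mul_column, Matrix.det_mul_row, prod_permSign_emb,
    prod_permSign_emb]

theorem sum_wt_emb {n k : ℕ} (hk : 1 ≤ k) (hkn : k ≤ n) (w : Weight n ≃ₗ[ℤ] Weight n) :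
    w (fundWeight (node n k hk hkn)) = ∑ a, w (wt (emb hkn a)) := by
  rw [fundWeight_eq_sum, map_sum]
  symm
  refine Finset.sum_bij (fun a _ => Fin.castLE hkn a) ?_ ?_ ?_ ?_
  · intro a _
    rw [Finset.mem_Iic, Fin.le_def]
    simp only [node, Fin.val_castLE]
    omega
  · intro a _ b _ h
    simpa using h
  · intro b hb
    rw [Finset.mem_Iic, Fin.le_def] at hb
    simp only [node] at hb
    exact ⟨⟨b, by omega⟩, Finset.mem_univ _, rfl⟩
  · intro a _
    rfl

theorem epsCoord_sum {n k : ℕ} (ρ : Fin k → J n) (hρ : Function.Injective ρ) (i : Fin n) :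
    epsCoord i (∑ a, wt (ρ a)) = (open Classical in (if Sum.inl i ∈ Set.range ρ then 1 else 0)) -
      (open Classical in (if Sum.inr i ∈ Set.range ρ then 1 else 0)) := by
  classical
  have h1 : epsCoord i (∑ a, wt (ρ a)) = ∑ a, epsCoord i (wt (ρ a)) := by
    simp only [epsCoord, Finset.sum_apply]
    exact Finset.sum_comm
  have h2 : ∀ j : J n, epsCoord i (wt j) =
      (if j = Sum.inl i then 1 else 0) - (if j = Sum.inr i then 1 else 0) := by
    rintro (a | a)
    · rw [epsCoord_wt_inl]; simp [eq_comm]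
    · rw [epsCoord_wt_inr]; simp only [reduceCtorEq, if_false, Sum.inr.injEq]; grind
  have h3 : ∀ j : J n, ∑ a, (if ρ a = j then 1 else 0 : ℤ) = if j ∈ Set.range ρ then 1 else 0 := by
    intro j
    split_ifs with h
    · obtain ⟨b, rfl⟩ := h
      simp [hρ.eq_iff]
    · refine Finset.sum_eq_zero fun a _ => if_neg fun ha => h ⟨a, ha⟩
  rw [h1]
  simp only [h2, Finset.sum_sub_distrib, h3]

/-- A set of indices that contains no pair `i`, `ī` is determined by its weight. -/
theorem range_eq_of_sum_wt_eq {n k : ℕ} {ρ ρ' : Fin k → J n} (hρ : Function.Injective ρ)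
    (hρ' : Function.Injective ρ') (hb : ∀ a b, ρ a ≠ bar (ρ b)) (hb' : ∀ a b, ρ' a ≠ bar (ρ' b))
    (h : ∑ a, wt (ρ a) = ∑ a, wt (ρ' a)) : Set.range ρ = Set.range ρ' := by
  classical
  have hs : ∀ {ρ : Fin k → J n}, (∀ a b, ρ a ≠ bar (ρ b)) → ∀ i : Fin n,
      ¬ (Sum.inl i ∈ Set.range ρ ∧ Sum.inr i ∈ Set.range ρ) := by
    rintro ρ h i ⟨⟨a, ha⟩, ⟨b, hb⟩⟩
    exact h a b (by rw [ha, hb, bar_inr])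
  have key : ∀ i : Fin n, (Sum.inl i ∈ Set.range ρ ↔ Sum.inl i ∈ Set.range ρ') ∧
      (Sum.inr i ∈ Set.range ρ ↔ Sum.inr i ∈ Set.range ρ') := by
    intro i
    -- The ε_i-coefficient is [i occurs] - [ī occurs]. As both cannot occur, its value 1, -1 or 0
    -- tells which of them does.
    have h1 := epsCoord_sum ρ hρ i
    rw [h, epsCoord_sum ρ' hρ' i] at h1
    have h2 := hs hb i
    have h3 := hs hb' i
    split_ifs at h1 <;> simp_all
  ext (i | i)
  · exact (key i).1
  · exact (key i).2

/-! ### Triangular decomposition -/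

theorem blockTriangular_mul_diag {n : ℕ} {A B : Matrix (J n) (J n) ℂ}
    (hA : A.BlockTriangular rank) (hB : B.BlockTriangular rank) (r : J n) :
    (A * B) r r = A r r * B r r := by
  rw [Matrix.mul_apply, Finset.sum_eq_single r]
  · intro t _ ht
    rcases lt_or_gt_of_ne (rank_injective.ne ht) with h | h
    · rw [hA h, zero_mul]
    · rw [hB h, mul_zero]
  · simp

theorem det_of_blockTriangular {m : Type*} [Fintype m] [DecidableEq m] {b : m → ℕ}
    (hb : Function.Injective b) {M : Matrix m m ℂ} (hM : M.BlockTriangular b) :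
    M.det = ∏ r, M r r := by
  let _ : LinearOrder m := LinearOrder.lift' b hb
  convert Matrix.det_of_isUpperTriangular (M := M) fun r t h => hM h

/-- Gaussian elimination: a nonzero leading minor allows the entries of row r to the left of the
diagonal to be cancelled by a combination of the earlier rows of M. -/
theorem exists_lower_mul_blockTriangular {n : ℕ} (M : Matrix (J n) (J n) ℂ)
    (hM : ∀ r : J n, (M.submatrix (Subtype.val : {t // rank t < rank r} → J n) Subtype.val).det ≠ 0) :
    ∃ L : Matrix (J n) (J n) ℂ, Lᵀ.BlockTriangular rank ∧ (∀ r, L r r = 1) ∧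
      (L * M).BlockTriangular rank := by
  have hx : ∀ r : J n, ∃ v : {t : J n // rank t < rank r} → ℂ,
      ∀ c : {t : J n // rank t < rank r}, ∑ t, v t * M t.1 c.1 = -M r c.1 := by
    intro r
    set A := M.submatrix (Subtype.val : {t // rank t < rank r} → J n) Subtype.val with hA
    refine ⟨(fun c => -M r c.1) ᵥ* A⁻¹, fun c => ?_⟩
    have h1 : ((fun c : {t // rank t < rank r} => -M r c.1) ᵥ* A⁻¹) ᵥ* A = fun c => -M r c.1 := by
      rw [Matrix.vecMul_vecMul, Matrix.nonsing_inv_mul _ (isUnit_iff_ne_zero.mpr (hM r)),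
        Matrix.vecMul_one]
    exact congrFun h1 c
  choose v hv using hx
  let X : Matrix (J n) (J n) ℂ := Matrix.of fun r t =>
    if h : rank t < rank r then v r ⟨t, h⟩ else 0
  refine ⟨1 + X, ?_, ?_, ?_⟩
  · intro r t h
    have : r ≠ t := fun h' => by rw [h'] at h; omega
    simp only [Matrix.transpose_apply, Matrix.add_apply, Matrix.one_apply_ne this.symm, X,
      Matrix.of_apply, dif_neg h.not_gt, add_zero]
  · intro r
    simp [X]
  · intro r c hc
    rw [add_mul, one_mul, Matrix.add_apply, Matrix.mul_apply,
      ← Fintype.sum_subtype_add_sum_subtype (fun t => rank t < rank r)]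
    have h1 : ∑ t : {t // rank t < rank r}, X r t.1 * M t.1 c = -M r c := by
      rw [← hv r ⟨c, hc⟩]
      refine Finset.sum_congr rfl fun t _ => ?_
      simp only [X, Matrix.of_apply, dif_pos t.2]
    have h2 : ∑ t : {t // ¬ rank t < rank r}, X r t.1 * M t.1 c = 0 := by
      refine Finset.sum_eq_zero fun t _ => ?_
      simp only [X, Matrix.of_apply, dif_neg t.2, zero_mul]
    rw [h1, h2]
    ring

/-- The sign of a basis vector in the symplectic form. -/
def formSign {n : ℕ} : J n → ℂ
  | Sum.inl a => (-1) ^ (a : ℕ)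
  | Sum.inr a => -(-1) ^ (a : ℕ)

theorem formSign_mul_self {n : ℕ} (j : J n) : formSign j * formSign j = 1 := by
  rcases j with a | a <;> simp [formSign, ← mul_pow]

theorem Ω_mul_Ω (n : ℕ) : Ω n * Ω n = -1 := by
  ext r t
  rcases r with a | a <;> rcases t with b | b <;>
    simp only [Ω_mul_inl, Ω_mul_inr, Matrix.neg_apply, Matrix.one_apply] <;>
    simp only [Ω, Matrix.of_apply, Sum.inl.injEq, Sum.inr.injEq, reduceCtorEq, if_false] <;>
    (try split_ifs) <;> simp_all [← mul_pow, neg_mul]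

/-- The adjoint with respect to the symplectic form. -/
def adj {n : ℕ} (M : Matrix (J n) (J n) ℂ) : Matrix (J n) (J n) ℂ := -(Ω n * Mᵀ * Ω n)

theorem adj_apply {n : ℕ} (M : Matrix (J n) (J n) ℂ) (r t : J n) :
    adj M r t = formSign r * formSign t * M (bar t) (bar r) := by
  rcases r with a | a <;> rcases t with b | b <;>
    simp only [adj, Matrix.neg_apply, mul_Ω_inl, mul_Ω_inr, Ω_mul_inl, Ω_mul_inr, formSign, bar,
      Sum.swap_inl, Sum.swap_inr, Matrix.transpose_apply] <;> ring

theorem adj_mul {n : ℕ} (A B : Matrix (J n) (J n) ℂ) : adj (A * B) = adj B * adj A := by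
  have : adj B * adj A = Ω n * Bᵀ * (Ω n * Ω n) * Aᵀ * Ω n := by
    simp only [adj, neg_mul_neg, mul_assoc]
  rw [this, Ω_mul_Ω, adj, Matrix.transpose_mul]
  simp [mul_assoc]

theorem adj_one {n : ℕ} : adj (1 : Matrix (J n) (J n) ℂ) = 1 := by
  rw [adj, Matrix.transpose_one, mul_one, Ω_mul_Ω, neg_neg]

theorem adj_mul_mat {n : ℕ} (g : G n) : adj (mat g) * mat g = 1 := by
  have h : (mat g)ᵀ * Ω n * mat g = Ω n := g.2
  have : adj (mat g) * mat g = -(Ω n * ((mat g)ᵀ * Ω n * mat g)) := by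
    simp only [adj, neg_mul, mul_assoc]
  rw [this, h, Ω_mul_Ω, neg_neg]

/-- A matrix that preserves the symplectic form, as an element of the group. -/
theorem exists_mat_eq {n : ℕ} {M : Matrix (J n) (J n) ℂ} (h : adj M * M = 1) :
    ∃ g : G n, mat g = M := by
  refine ⟨⟨⟨M, adj M, mul_eq_one_comm.mp h, h⟩, ?_⟩, rfl⟩
  show Mᵀ * Ω n * M = Ω n
  have h1 : Ω n * (adj M * M) = -(Ω n * Ω n) * (Mᵀ * Ω n * M) := by
    simp only [adj, neg_mul, mul_neg, mul_assoc]
  rw [h, Ω_mul_Ω, neg_neg, one_mul, mul_one] at h1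
  exact h1.symm

/-- Up to signs the adjoint is reflection in the antidiagonal. -/
theorem blockTriangular_adj {n : ℕ} {M : Matrix (J n) (J n) ℂ} (h : M.BlockTriangular rank) :
    (adj M).BlockTriangular rank := by
  intro r t hrt
  have := rank_lt r
  rw [adj_apply, h, mul_zero]
  rw [rank_bar, rank_bar]
  omega

theorem transpose_adj {n : ℕ} (M : Matrix (J n) (J n) ℂ) : (adj M)ᵀ = adj Mᵀ := by
  ext r t
  rw [Matrix.transpose_apply, adj_apply, adj_apply, Matrix.transpose_apply]
  ring

theorem adj_diag {n : ℕ} (M : Matrix (J n) (J n) ℂ) (r : J n) :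
    adj M r r = M (bar r) (bar r) := by
  rw [adj_apply, formSign_mul_self, one_mul]

theorem character_wt_inl {n : ℕ} (i : Fin n) (a : Fin n → ℂˣ) :
    character (wt (Sum.inl i)) a =
      a i * if h : 0 < (i : ℕ) then (a ⟨i - 1, by omega⟩)⁻¹ else 1 := by
  have hk : ∀ k, a k ^ wt (Sum.inl i) k =
      (if k = i then a k else 1) * if (k : ℕ) + 1 = i then (a k)⁻¹ else 1 := by
    intro k
    simp only [wt]
    split_ifs <;> first | omega | simp
  simp only [character, hk, Finset.prod_mul_distrib, Finset.prod_ite_eq', Finset.mem_univ, if_true]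
  congr 1
  split_ifs with h0
  · rw [Finset.prod_eq_single ⟨i - 1, by omega⟩]
    · rw [if_pos]; simp only; omega
    · intro k _ hk
      rw [if_neg]
      intro h; apply hk; apply Fin.ext; simp only; omega
    · simp
  · refine Finset.prod_eq_one fun k _ => if_neg (by omega)

theorem exists_torus {n : ℕ} (d : J n → ℂ) (hd : ∀ j, d (bar j) * d j = 1) :
    ∃ a : Fin n → ℂˣ, mat (torus a) = Matrix.diagonal d := by
  let D : Fin n → ℂˣ := fun i => Units.mk0 (d (Sum.inl i)) (right_ne_zero_of_mul_eq_one (hd _))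
  -- Since wt v_i = Λ_i - Λ_{i-1}, the torus coordinates are the partial products of the diagonal
  -- entries.
  let a : Fin n → ℂˣ := fun i => ∏ k ∈ Finset.Iic i, D k
  have h1 : ∀ i, character (wt (Sum.inl i)) a = D i := by
    intro i
    rw [character_wt_inl]
    split_ifs with h0
    · have : Finset.Iic i = insert i (Finset.Iic ⟨i - 1, by omega⟩) := by
        ext k
        simp only [Finset.mem_Iic, Finset.mem_insert, Fin.le_def, Fin.ext_iff]
        omega
      simp only [a]
      rw [this, Finset.prod_insert, mul_inv_cancel_right]
      simp only [Finset.mem_Iic, Fin.le_def]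
      omega
    · have : Finset.Iic i = {i} := by
        ext k
        simp only [Finset.mem_Iic, Finset.mem_singleton, Fin.le_def, Fin.ext_iff]
        omega
      simp only [a, this, Finset.prod_singleton, mul_one]
  refine ⟨a, ?_⟩
  show Matrix.diagonal _ = _
  congr 1
  ext1 j
  have hinl : ∀ i, (character (wt (Sum.inl i)) a : ℂ) = d (Sum.inl i) := fun i => by rw [h1]; rfl
  rcases j with i | i
  · exact hinl i
  · have h2 := character_wt_inl_mul_inr i a
    have h3 : d (Sum.inl i) * (character (wt (Sum.inr i)) a : ℂ) = 1 := by
      rw [← hinl, ← Units.val_mul, h2, Units.val_one]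
    have h4 := hd (Sum.inl i)
    rw [bar_inl] at h4
    calc (character (wt (Sum.inr i)) a : ℂ) = (d (Sum.inr i) * d (Sum.inl i)) * _ := by
          rw [h4, one_mul]
      _ = d (Sum.inr i) := by rw [mul_assoc, h3, mul_one]

theorem mat_inv_mul {n : ℕ} (g : G n) : mat g⁻¹ * mat g = 1 := by
  rw [← mat_mul, inv_mul_cancel, mat_one]

/-- Elements of the group with nonvanishing leading minors lie in the big cell `U⁻ T U`. -/
theorem exists_eq_lower_mul_torus_mul_upper {n : ℕ} (g : G n)
    (hg : ∀ r : J n,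
      ((mat g).submatrix (Subtype.val : {t // rank t < rank r} → J n) Subtype.val).det ≠ 0) :
    ∃ (u v : G n) (a : Fin n → ℂˣ), IsLowerUnipotent u ∧ IsUpperUnipotent v ∧
      g = u * torus a * v := by
  obtain ⟨L, hL, hL1, hP⟩ := exists_lower_mul_blockTriangular (mat g) hg
  have hLdet : L.det = 1 := by
    rw [← Matrix.det_transpose, det_of_blockTriangular rank_injective hL]
    simp [hL1]
  set P := L * mat g with hPdef
  have hLu : IsUnit L.det := by rw [hLdet]; exact isUnit_one
  have hgu : IsUnit (mat g).det := by
    have := congrArg Matrix.det (mat_inv_mul g)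
    rw [Matrix.det_mul, Matrix.det_one] at this
    exact IsUnit.of_mul_eq_one_right _ this
  have hPu : IsUnit P.det := by rw [hPdef, Matrix.det_mul]; exact hLu.mul hgu
  set K := L⁻¹ with hK
  have hKL : K * L = 1 := Matrix.nonsing_inv_mul _ hLu
  have hLK : L * K = 1 := Matrix.mul_nonsing_inv _ hLu
  have hKt : Kᵀ.BlockTriangular rank := by
    let _ := Matrix.invertibleOfIsUnitDet Lᵀ (by rw [Matrix.det_transpose]; exact hLu)
    rw [hK, Matrix.transpose_nonsing_inv]
    exact Matrix.blockTriangular_inv_of_blockTriangular hL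
  have hPi : P⁻¹.BlockTriangular rank := by
    let _ := Matrix.invertibleOfIsUnitDet P hPu
    exact Matrix.blockTriangular_inv_of_blockTriangular hP
  have hPP : P * P⁻¹ = 1 := Matrix.mul_nonsing_inv _ hPu
  have hgKP : mat g = K * P := by rw [hPdef, ← mul_assoc, hKL, one_mul]
  have hK1 : ∀ r, K r r = 1 := by
    intro r
    have h1 := blockTriangular_mul_diag hKt hL r
    rw [← Matrix.transpose_mul, hLK, Matrix.transpose_one, Matrix.one_apply_eq,
      Matrix.transpose_apply, Matrix.transpose_apply, hL1, mul_one] at h1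
    exact h1.symm
  -- For g = K P symplectic, this equates a lower unitriangular matrix with an upper triangular one.
  -- Both are then 1, so K and P are symplectic separately.
  have hAK : adj K * K = adj P⁻¹ * P⁻¹ := by
    have h1 := adj_mul_mat g
    rw [hgKP, adj_mul] at h1
    have h2 : adj P⁻¹ * adj P = 1 := by rw [← adj_mul, hPP, adj_one]
    calc adj K * K = (adj P⁻¹ * adj P) * (adj K * K) * (P * P⁻¹) := by rw [h2, hPP]; simp
      _ = adj P⁻¹ * (adj P * adj K * (K * P)) * P⁻¹ := by simp only [mul_assoc]
      _ = _ := by rw [h1, mul_one]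
  have hup : (adj K * K).BlockTriangular rank := by
    rw [hAK]; exact (blockTriangular_adj hPi).mul hPi
  have hlow : (adj K * K)ᵀ.BlockTriangular rank := by
    rw [Matrix.transpose_mul, transpose_adj]; exact hKt.mul (blockTriangular_adj hKt)
  have hKK : adj K * K = 1 := by
    ext r t
    rcases lt_trichotomy (rank r) (rank t) with h | h | h
    · have h1 := hlow h
      rw [Matrix.transpose_apply] at h1
      rw [h1, Matrix.one_apply_ne (fun h' => by rw [h'] at h; omega)]
    · rw [rank_injective h, Matrix.one_apply_eq]
      have h1 := blockTriangular_mul_diag hKt (blockTriangular_adj hKt) t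
      rw [← transpose_adj, ← Matrix.transpose_mul] at h1
      simp only [Matrix.transpose_apply, adj_diag, hK1, mul_one] at h1
      exact h1
    · rw [hup h, Matrix.one_apply_ne (fun h' => by rw [h'] at h; omega)]
  have hPPadj : adj P * P = 1 := by
    have h1 := adj_mul_mat g
    rw [hgKP, adj_mul] at h1
    calc adj P * P = adj P * (adj K * K) * P := by rw [hKK, mul_one]
      _ = 1 := by rw [← h1]; simp only [mul_assoc]
  have hd : ∀ j, P (bar j) (bar j) * P j j = 1 := by
    intro j
    have h1 := blockTriangular_mul_diag (blockTriangular_adj hP) hP j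
    rw [hPPadj, Matrix.one_apply_eq, adj_diag] at h1
    exact h1.symm
  obtain ⟨u, hu⟩ := exists_mat_eq hKK
  obtain ⟨a, ha⟩ := exists_torus (fun j => P j j) hd
  have hv : P = Matrix.diagonal (fun j => P j j) * mat ((u * torus a)⁻¹ * g) := by
    have h1 : mat (u * torus a) * mat ((u * torus a)⁻¹ * g) = mat g := by
      rw [← mat_mul, mul_inv_cancel_left]
    rw [mat_mul, hu, ha, hgKP, mul_assoc] at h1
    have h2 := congrArg (L * ·) h1
    simp only [← mul_assoc, hLK, one_mul] at h2
    exact h2.symm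
  have hvr : ∀ r t, P r t = P r r * mat ((u * torus a)⁻¹ * g) r t := by
    intro r t
    conv_lhs => rw [hv]
    rw [Matrix.diagonal_mul]
  have hP0 : ∀ r, P r r ≠ 0 := fun r => right_ne_zero_of_mul_eq_one (hd r)
  refine ⟨u, (u * torus a)⁻¹ * g, a, ⟨?_, ?_⟩, ⟨?_, ?_⟩, (mul_inv_cancel_left _ _).symm⟩
  · rw [hu]; exact hK1
  · intro r t h
    rw [hu]
    exact hKt h
  · intro r
    have := hvr r r
    exact (mul_right_eq_self₀.mp this.symm).resolve_right (hP0 r)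
  · intro r t h
    have h1 := hvr r t
    rw [hP h] at h1
    exact (mul_eq_zero.mp h1.symm).resolve_left (hP0 r)

/-! ### Uniqueness of the principal minors -/

/-- Elements that are joined to the maximal torus by a polynomial curve. -/
def JoinedToTorus {n : ℕ} (g : G n) : Prop :=
  ∃ γ : ℂ → G n, (∃ p : Matrix (J n) (J n) (Polynomial ℂ),
      ∀ z, mat (γ z) = p.map (Polynomial.eval z)) ∧ γ 1 = g ∧ ∃ a, γ 0 = torus a

theorem mat_torus {n : ℕ} (a : Fin n → ℂˣ) :
    mat (torus a) = Matrix.diagonal fun j => (character (wt j) a : ℂ) := rfl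

theorem character_mul {n : ℕ} (lam : Weight n) (a b : Fin n → ℂˣ) :
    character lam (a * b) = character lam a * character lam b := by
  simp [character, mul_zpow, Finset.prod_mul_distrib]

theorem torus_mul {n : ℕ} (a b : Fin n → ℂˣ) : torus a * torus b = torus (a * b) := by
  apply mat_injective
  rw [mat_mul, mat_torus, mat_torus, mat_torus, Matrix.diagonal_mul_diagonal]
  simp [character_mul]

theorem JoinedToTorus.mul {n : ℕ} {g h : G n} (hg : JoinedToTorus g) (hh : JoinedToTorus h) :
    JoinedToTorus (g * h) := by
  obtain ⟨γ, ⟨p, hp⟩, h1, a, ha⟩ := hg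
  obtain ⟨δ, ⟨q, hq⟩, h1', b, hb⟩ := hh
  refine ⟨fun z => γ z * δ z, ⟨p * q, fun z => ?_⟩, by simp only [h1, h1'], a * b, by
    simp only [ha, hb, torus_mul]⟩
  rw [mat_mul, hp, hq]
  exact (Matrix.map_mul (f := Polynomial.evalRingHom z)).symm

theorem joinedToTorus_torus {n : ℕ} (a : Fin n → ℂˣ) : JoinedToTorus (torus a) := by
  refine ⟨fun _ => torus a, ⟨(mat (torus a)).map Polynomial.C, fun z => ?_⟩, rfl, a, rfl⟩
  ext r t
  simp

theorem torus_one {n : ℕ} : torus (1 : Fin n → ℂˣ) = 1 := by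
  apply mat_injective
  rw [mat_torus, mat_one]
  simp [character]

theorem joinedToTorus_one {n : ℕ} : JoinedToTorus (1 : G n) := by
  rw [← torus_one]; exact joinedToTorus_torus 1

theorem joinedToTorus_x {n : ℕ} (i : Fin n) (c : ℂ) : JoinedToTorus (x i c) := by
  refine ⟨fun z => x i (z * c), ⟨1 + (Polynomial.X * Polynomial.C c) • (e i).map Polynomial.C,
    fun z => ?_⟩, by simp, 1, ?_⟩
  · ext r t
    simp [mat_x, Matrix.one_apply, apply_ite (Polynomial.eval z), mul_comm c]
  · apply mat_injective
    rw [torus_one, mat_x]; simp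

theorem joinedToTorus_y {n : ℕ} (i : Fin n) (c : ℂ) : JoinedToTorus (y i c) := by
  refine ⟨fun z => y i (z * c), ⟨1 + (Polynomial.X * Polynomial.C c) • (f i).map Polynomial.C,
    fun z => ?_⟩, by simp, 1, ?_⟩
  · ext r t
    simp [mat_y, Matrix.one_apply, apply_ite (Polynomial.eval z), mul_comm c]
  · apply mat_injective
    rw [torus_one, mat_y]; simp

theorem JoinedToTorus.list_prod {n : ℕ} {L : List (G n)} (h : ∀ g ∈ L, JoinedToTorus g) :
    JoinedToTorus L.prod := by
  induction L with
  | nil => exact joinedToTorus_one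
  | cons g L ih =>
    rw [List.prod_cons]
    exact (h g (by simp)).mul (ih fun g' hg' => h g' (by simp [hg']))

theorem joinedToTorus_sBar {n : ℕ} (i : Fin n) : JoinedToTorus (sBar i) :=
  ((joinedToTorus_x i _).mul (joinedToTorus_y i _)).mul (joinedToTorus_x i _)

theorem x_inv {n : ℕ} (i : Fin n) (c : ℂ) : (x i c)⁻¹ = x i (-c) := by
  apply inv_eq_of_mul_eq_one_left
  apply mat_injective
  rw [mat_mul, mat_x, mat_x, mat_one]
  simp [mul_add, add_mul, e_mul_e]

theorem y_inv {n : ℕ} (i : Fin n) (c : ℂ) : (y i c)⁻¹ = y i (-c) := by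
  apply inv_eq_of_mul_eq_one_left
  apply mat_injective
  rw [mat_mul, mat_y, mat_y, mat_one]
  simp [mul_add, add_mul, f_mul_f]

theorem joinedToTorus_sBar_inv {n : ℕ} (i : Fin n) : JoinedToTorus (sBar i)⁻¹ := by
  rw [sBar, mul_inv_rev, mul_inv_rev, x_inv, y_inv]
  exact (joinedToTorus_x i _).mul ((joinedToTorus_y i _).mul (joinedToTorus_x i _))

theorem joinedToTorus_prod_sBar_inv {n : ℕ} (l : List (Fin n)) :
    JoinedToTorus (l.map sBar).prod⁻¹ := by
  rw [List.prod_inv_reverse]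
  refine JoinedToTorus.list_prod fun g hg => ?_
  simp only [List.map_map, List.mem_reverse, List.mem_map, Function.comp] at hg
  obtain ⟨i, _, rfl⟩ := hg
  exact joinedToTorus_sBar_inv i

theorem joinedToTorus_prod_sBar {n : ℕ} (l : List (Fin n)) :
    JoinedToTorus (l.map sBar).prod := by
  refine JoinedToTorus.list_prod fun g hg => ?_
  obtain ⟨i, _, rfl⟩ := List.mem_map.mp hg
  exact joinedToTorus_sBar i

theorem joinedToTorus_Θ {n : ℕ} (c : Fin n → Fin n → ℂˣ) : JoinedToTorus (Θ c) := by
  refine JoinedToTorus.list_prod fun g hg => ?_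
  obtain ⟨j, rfl⟩ := (List.mem_ofFn' _ _).mp hg
  refine JoinedToTorus.list_prod fun g hg => ?_
  obtain ⟨i, rfl⟩ := (List.mem_ofFn' _ _).mp hg
  exact (joinedToTorus_y i _).mul (joinedToTorus_torus _)

theorem IsRegular.exists_polynomial {n : ℕ} {F : G n → ℂ} (hF : IsRegular F) {γ : ℂ → G n}
    {p : Matrix (J n) (J n) (Polynomial ℂ)} (hp : ∀ z, mat (γ z) = p.map (Polynomial.eval z)) :
    ∃ P : Polynomial ℂ, ∀ z, F (γ z) = P.eval z := by
  obtain ⟨q, hq⟩ := hF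
  refine ⟨MvPolynomial.eval₂ Polynomial.C (fun k => p k.1 k.2) q, fun z => ?_⟩
  rw [hq, ← Polynomial.coe_evalRingHom, MvPolynomial.eval₂_comp_left]
  have : (Polynomial.evalRingHom z).comp Polynomial.C = RingHom.id ℂ := by ext; simp
  rw [this, MvPolynomial.eval, MvPolynomial.coe_eval₂Hom, hp]
  rfl

/-- Along the curve both functions are polynomials in z, and they agree wherever all proper leading
minors are nonzero, by the triangular decomposition. The product of these minors is a nonzero
polynomial, since at z = 0 the curve is in the torus. Density of the big cell in the group is thus
not needed. -/
theorem IsPrincipalMinor.eq_of_joinedToTorus {n : ℕ} {mu : Weight n} {F F' : G n → ℂ}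
    (hF : IsPrincipalMinor mu F) (hF' : IsPrincipalMinor mu F') {g : G n}
    (hg : JoinedToTorus g) : F g = F' g := by
  obtain ⟨γ, ⟨p, hp⟩, rfl, a, ha⟩ := hg
  obtain ⟨P, hP⟩ := hF.1.exists_polynomial hp
  obtain ⟨P', hP'⟩ := hF'.1.exists_polynomial hp
  let B : J n → Polynomial ℂ := fun r =>
    (p.submatrix (Subtype.val : {t // rank t < rank r} → J n) Subtype.val).det
  have hB : ∀ z r, (B r).eval z =
      ((mat (γ z)).submatrix (Subtype.val : {t // rank t < rank r} → J n) Subtype.val).det := by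
    intro z r
    rw [hp, ← Polynomial.coe_evalRingHom, RingHom.map_det]
    rfl
  have hB0 : (∏ r, B r).eval 0 ≠ 0 := by
    rw [Polynomial.eval_prod, Finset.prod_ne_zero_iff]
    intro r _
    rw [hB, ha, mat_torus, Matrix.submatrix_diagonal _ _ Subtype.val_injective, Matrix.det_diagonal,
      Finset.prod_ne_zero_iff]
    intro t _
    exact Units.ne_zero _
  have hz : (P - P') * ∏ r, B r = 0 := by
    apply Polynomial.funext
    intro z
    rw [Polynomial.eval_mul, Polynomial.eval_zero]
    by_cases hne : (∏ r, B r).eval z = 0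
    · rw [hne, mul_zero]
    · rw [Polynomial.eval_prod, ← ne_eq, Finset.prod_ne_zero_iff] at hne
      obtain ⟨u, v, b, hu, hv, hγ⟩ := exists_eq_lower_mul_torus_mul_upper (γ z) fun r => by
        rw [← hB]; exact hne r (Finset.mem_univ _)
      rw [Polynomial.eval_sub, ← hP, ← hP', hγ, hF.2 u v b hu hv, hF'.2 u v b hu hv, sub_self,
        zero_mul]
  rcases mul_eq_zero.mp hz with h | h
  · rw [hP, hP', sub_eq_zero.mp h]
  · rw [h] at hB0; simp at hB0

/-! ### The principal minors of the fundamental weights -/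

theorem sum_eq_sum_emb {n k : ℕ} (hk : k ≤ n) (F : J n → ℂ) (h : ∀ j, k ≤ rank j → F j = 0) :
    ∑ j, F j = ∑ a, F (emb hk a) := by
  have : ∑ a, F (emb hk a) = ∑ j ∈ Finset.univ.map ⟨emb hk, emb_injective hk⟩, F j := by
    rw [Finset.sum_map]; rfl
  rw [this]
  symm
  apply Finset.sum_subset (Finset.subset_univ _)
  intro j _ hj
  apply h
  by_contra hc
  apply hj
  rw [Finset.mem_map]
  exact ⟨⟨rank j, by omega⟩, Finset.mem_univ _, rank_injective rfl⟩

theorem character_sum {n : ℕ} {ι : Type*} (S : Finset ι) (lam : ι → Weight n) (a : Fin n → ℂˣ) :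
    character (∑ i ∈ S, lam i) a = ∏ i ∈ S, character (lam i) a := by
  simp only [character, Finset.sum_apply]
  rw [Finset.prod_comm]
  refine Finset.prod_congr rfl fun k _ => ?_
  exact map_sum (zpowersHom ℂˣ (a k)).toAdditiveRight (fun i => lam i k) S

theorem isPrincipalMinor_leadingMinor {n k : ℕ} (hk : 1 ≤ k) (hkn : k ≤ n) :
    IsPrincipalMinor (fundWeight (node n k hk hkn)) fun g => leadingMinor hkn (mat g) := by
  constructor
  · refine ⟨(Matrix.of fun a b => MvPolynomial.X (emb hkn a, emb hkn b)).det, fun g => ?_⟩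
    rw [RingHom.map_det]
    refine congrArg Matrix.det ?_
    ext a b
    simp
  · intro u v a hu hv
    -- Because v is upper triangular, passing to the first k indices is compatible with the product.
    have h1 : (mat (u * torus a * v)).submatrix (emb hkn) (emb hkn) =
        (mat u).submatrix (emb hkn) (emb hkn) *
          (Matrix.diagonal fun b => (character (wt (emb hkn b)) a : ℂ)) *
          (mat v).submatrix (emb hkn) (emb hkn) := by
      ext b c
      simp only [Matrix.submatrix_apply, mat_mul, mat_torus]
      rw [Matrix.mul_apply, sum_eq_sum_emb hkn, Matrix.mul_apply]
      · simp [Matrix.mul_diagonal]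
      · intro j hj
        rw [hv.2 j, mul_zero]
        rw [rank_emb]
        omega
    show ((mat (u * torus a * v)).submatrix (emb hkn) (emb hkn)).det = _
    rw [h1, Matrix.det_mul, Matrix.det_mul, Matrix.det_diagonal,
      Matrix.det_of_isLowerTriangular ((mat u).submatrix (emb hkn) (emb hkn)),
      Matrix.det_of_isUpperTriangular (M := (mat v).submatrix (emb hkn) (emb hkn))]
    · have h2 := sum_wt_emb hk hkn (LinearEquiv.refl ℤ _)
      simp only [LinearEquiv.refl_apply] at h2
      rw [h2, character_sum]
      simp [hu.1, hv.1]
    · intro b c hbc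
      exact hv.2 _ _ hbc
    · intro b c hbc
      exact hu.2 _ _ hbc

theorem principalMinor_eq {n k : ℕ} (hk : 1 ≤ k) (hkn : k ≤ n) {g : G n} (hg : JoinedToTorus g) :
    principalMinor (fundWeight (node n k hk hkn)) g = leadingMinor hkn (mat g) :=
  IsPrincipalMinor.eq_of_joinedToTorus
    (Classical.epsilon_spec (p := IsPrincipalMinor (fundWeight (node n k hk hkn)))
      ⟨_, isPrincipalMinor_leadingMinor hk hkn⟩) (isPrincipalMinor_leadingMinor hk hkn) hg

/-- A generalized minor as a signed minor of the matrix. -/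
theorem generalizedMinor_eq {n k : ℕ} (hk : 1 ≤ k) (hkn : k ≤ n) {gam : Weight n}
    (hgam : ∃ w : weylGroup n, (w : Weight n ≃ₗ[ℤ] Weight n) (fundWeight (node n k hk hkn)) = gam)
    {ρ : Fin k → J n} (hρ : Function.Injective ρ) (hb : ∀ a b, ρ a ≠ bar (ρ b))
    (hsum : ∑ a, wt (ρ a) = gam) {g : G n} (hg : JoinedToTorus g) :
    generalizedMinor (fundWeight (node n k hk hkn)) gam (fundWeight (node n k hk hkn)) g =
      seqSign ρ * ((mat g).submatrix ρ (emb hkn)).det := by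
  unfold generalizedMinor weylRep
  have hu := Classical.epsilon_spec hgam
  have hv := Classical.epsilon_spec (p := fun w : weylGroup n =>
    (w : Weight n ≃ₗ[ℤ] Weight n) (fundWeight (node n k hk hkn)) = fundWeight (node n k hk hkn))
    ⟨1, rfl⟩
  dsimp only
  generalize Classical.epsilon (fun w : weylGroup n =>
    (w : Weight n ≃ₗ[ℤ] Weight n) (fundWeight (node n k hk hkn)) = gam) = u at hu ⊢
  generalize Classical.epsilon (fun w : weylGroup n =>
    (w : Weight n ≃ₗ[ℤ] Weight n) (fundWeight (node n k hk hkn)) =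
      fundWeight (node n k hk hkn)) = v at hv ⊢
  have hl := Classical.epsilon_spec (exists_isReducedWord u)
  have hl' := Classical.epsilon_spec (exists_isReducedWord v)
  generalize Classical.epsilon (fun l : List (Fin n) => IsReducedWord l u) = l at hl ⊢
  generalize Classical.epsilon (fun l : List (Fin n) => IsReducedWord l v) = l' at hl' ⊢
  rw [principalMinor_eq hk hkn (((joinedToTorus_prod_sBar_inv l).mul hg).mul
    (joinedToTorus_prod_sBar l')), leadingMinor_conj hkn hl hl']
  have hembb : ∀ a b, emb hkn a ≠ bar (emb hkn b) := by
    intro a b; simp [emb, bar]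
  have hinj : ∀ l : List (Fin n), Function.Injective (wordPerm l ∘ emb hkn) := fun l =>
    (wordPerm l).injective.comp (emb_injective hkn)
  have hbar : ∀ (l : List (Fin n)) a b,
      (wordPerm l ∘ emb hkn) a ≠ bar ((wordPerm l ∘ emb hkn) b) := by
    intro l a b
    simp only [Function.comp]
    rw [← wordPerm_bar, (Equiv.injective _).ne_iff]
    exact hembb a b
  have hsumw : ∀ {l : List (Fin n)} {w : weylGroup n}, IsReducedWord l w →
      ∑ a, wt ((wordPerm l ∘ emb hkn) a) =
        (w : Weight n ≃ₗ[ℤ] Weight n) (fundWeight (node n k hk hkn)) := by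
    intro l w h
    rw [sum_wt_emb, ← h.1]
    exact Finset.sum_congr rfl fun a _ => wt_wordPerm l _
  -- The element u is unknown, but the weight determines the set u{1, …, k}, so the rows may be
  -- listed by ρ instead.
  have hr1 : Set.range ρ = Set.range (wordPerm l ∘ emb hkn) :=
    range_eq_of_sum_wt_eq hρ (hinj l) hb (hbar l) (by rw [hsum, hsumw hl, hu])
  have hr2 : Set.range (emb hkn) = Set.range (wordPerm l' ∘ emb hkn) :=
    range_eq_of_sum_wt_eq (emb_injective hkn) (hinj l') hembb (hbar l') (by
      rw [hsumw hl', hv]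
      exact (sum_wt_emb hk hkn (LinearEquiv.refl ℤ _)).symm)
  rw [seqSign_mul_det_cols _ _ (emb_injective hkn) (hinj l') hr2, seqSign_emb, one_mul,
    seqSign_mul_det_rows _ _ hρ (hinj l) hr1]

/-! ### The matrix of the parametrization -/

/-- The matrix of `𝐲_1(q_1) ⋯ 𝐲_n(q_n)`, where `q_0 = 1`. -/
def stepMatrix (n : ℕ) (q : ℕ → ℂ) : Matrix (J n) (J n) ℂ := Matrix.of fun r t =>
  match r, t with
  | Sum.inl a, Sum.inl b => if a = b then q a / q (a + 1) else if (a : ℕ) = b + 1 then 1 else 0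
  | Sum.inl _, Sum.inr _ => 0
  | Sum.inr a, Sum.inl b => if (b : ℕ) + 1 = n then 1 / q a else 0
  | Sum.inr a, Sum.inr b => if a ≤ b then q (b + 1) / q a else 0

/-- The matrix of `𝐲_1(q_1) ⋯ 𝐲_p(q_p)`, where `q_0 = 1`. -/
def partialStepMatrix (n : ℕ) (q : ℕ → ℂ) (p : ℕ) : Matrix (J n) (J n) ℂ := Matrix.of fun r t =>
  match r, t with
  | Sum.inl a, Sum.inl b =>
    if a = b then (if (b : ℕ) < p then q a / q (a + 1) else if (b : ℕ) = p then q a else 1)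
    else if (a : ℕ) = b + 1 ∧ (b : ℕ) < p then 1 else 0
  | Sum.inl _, Sum.inr _ => 0
  | Sum.inr a, Sum.inl b => if (b : ℕ) < p ∧ (b : ℕ) + 1 = n then 1 / q a else 0
  | Sum.inr a, Sum.inr b =>
    if (b : ℕ) < p then (if a ≤ b then q (b + 1) / q a else 0)
    else if (b : ℕ) = p then (if a ≤ b then 1 / q a else 0)
    else if a = b then 1 else 0

theorem character_mulSingle {n : ℕ} (lam : Weight n) (i : Fin n) (a : ℂˣ) :
    character lam (Pi.mulSingle i a) = a ^ lam i := by
  rw [character, Finset.prod_eq_single i]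
  · simp
  · intro k _ hk
    simp [Pi.mulSingle_eq_of_ne hk]
  · simp

theorem mul_mat_bigY {n : ℕ} (i : Fin n) (a : ℂˣ) (W : Matrix (J n) (J n) ℂ) (r t : J n) :
    (W * mat (bigY i a)) r t = (W r t + (if t = Sum.inl i then a * W r (up i)
      else if t = bar (up i) then a * W r (Sum.inr i) else 0)) * (a : ℂ) ^ (-wt t i) := by
  have n3 : Sum.inl i ≠ up i := by
    rw [← rank_injective.ne_iff, rank_up, rank_inl]; omega
  have n1 : Sum.inl i = bar (up i) ↔ Sum.inr i = up i := by
    rw [← bar_inr, bar_injective.eq_iff]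
  have h1 : (W * f i) r t = if t = Sum.inl i then W r (up i)
      else if t = bar (up i) then W r (Sum.inr i) else 0 := by
    simp only [Matrix.mul_apply, f, Matrix.transpose_apply, e_apply]
    by_cases t1 : t = Sum.inl i
    · rw [Finset.sum_eq_single (up i)]
      · simp [t1]
      · intro b _ hb
        rw [if_neg, mul_zero]
        grind
      · simp
    by_cases t2 : t = bar (up i)
    · rw [Finset.sum_eq_single (Sum.inr i)]
      · subst t2; simp [t1]
      · intro b _ hb
        rw [if_neg, mul_zero]
        grind
      · simp
    simp [t1, t2]
  rw [bigY, mat_mul, mat_y, coroot, mat_torus, ← mul_assoc, Matrix.mul_diagonal, mul_add, mul_one,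
    Matrix.mul_smul, Matrix.add_apply, Matrix.smul_apply, h1, character_mulSingle]
  congr 1
  · simp only [smul_eq_mul, mul_ite, mul_zero]
  · simp

theorem mul_mat_bigY_inl {n : ℕ} (i : Fin n) (a : ℂˣ) (W : Matrix (J n) (J n) ℂ) (r : J n)
    (b : Fin n) : (W * mat (bigY i a)) r (Sum.inl b) =
      if b = i then W r (Sum.inl i) / a + W r (up i)
      else if (b : ℕ) = i + 1 then a * W r (Sum.inl b) else W r (Sum.inl b) := by
  have ha : (a : ℂ) ≠ 0 := a.ne_zero
  rw [mul_mat_bigY]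
  have h2 : Sum.inl b = bar (up i) → b = i := by
    intro h
    have h' := congrArg rank h
    rw [rank_bar, rank_up, rank_inl] at h'
    apply Fin.ext
    omega
  by_cases hb : b = i
  · subst hb
    simp [wt]
    field_simp
  · have h3 : ¬ Sum.inl b = bar (up i) := fun h => hb (h2 h)
    by_cases hb1 : (b : ℕ) = i + 1
    · simp [wt, hb, Ne.symm hb, h3, hb1, mul_comm]
    · simp [wt, hb, Ne.symm hb, h3, hb1, Ne.symm hb1]

theorem mul_mat_bigY_inr {n : ℕ} (i : Fin n) (a : ℂˣ) (W : Matrix (J n) (J n) ℂ) (r : J n)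
    (b : Fin n) : (W * mat (bigY i a)) r (Sum.inr b) =
      if b = i then a * W r (Sum.inr b)
      else if (b : ℕ) = i + 1 then W r (Sum.inr b) / a + W r (Sum.inr i) else W r (Sum.inr b) := by
  have ha : (a : ℂ) ≠ 0 := a.ne_zero
  rw [mul_mat_bigY]
  have h2 : Sum.inr b = bar (up i) ↔ (b : ℕ) = i + 1 := by
    rw [← rank_injective.eq_iff, rank_bar, rank_up, rank_inr]
    omega
  by_cases hb : b = i
  · subst hb
    simp [wt, h2, mul_comm]
  · by_cases hb1 : (b : ℕ) = i + 1
    · simp [wt, hb, Ne.symm hb, h2, hb1]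
      field_simp
    · simp [wt, hb, Ne.symm hb, h2, hb1, Ne.symm hb1]

/-- In each half, this factor affects only the columns with zero-based number i and i + 1, and the
latter is affected once more by the next factor. Hence the separate case b = p in the partial
products. -/
theorem partialStepMatrix_succ {n : ℕ} {q : ℕ → ℂ} (hq : ∀ i, q i ≠ 0) (i : Fin n) (a : ℂˣ)
    (ha : (a : ℂ) = q (i + 1)) :
    partialStepMatrix n q i * mat (bigY i a) = partialStepMatrix n q (i + 1) := by
  have h1 := hq i
  have h2 := hq (i + 1)
  ext r t
  rcases t with b | b
  · rw [mul_mat_bigY_inl, ha]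
    unfold up
    rcases r with c | c
    · by_cases hi : (i : ℕ) + 1 < n
      · simp only [partialStepMatrix, Matrix.of_apply, hi, dite_true]
        by_cases hb : b = i
        · subst hb
          by_cases hc : c = b
          · subst hc; simp [Fin.ext_iff]
          · simp only [hc, Fin.ext_iff] at *
            grind
        · simp only [Fin.ext_iff] at *
          grind
      · simp only [partialStepMatrix, Matrix.of_apply, hi, dite_false]
        simp only [Fin.ext_iff] at *
        grind
    · have h3 := hq c
      by_cases hi : (i : ℕ) + 1 < n
      · simp only [partialStepMatrix, Matrix.of_apply, hi, dite_true]
        simp only [Fin.ext_iff] at *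
        grind
      · simp only [partialStepMatrix, Matrix.of_apply, hi, dite_false]
        simp only [Fin.ext_iff, Fin.le_def] at *
        grind
  · rw [mul_mat_bigY_inr, ha]
    rcases r with c | c
    · simp [partialStepMatrix]
    · have h3 := hq c
      simp only [partialStepMatrix, Matrix.of_apply]
      simp only [Fin.ext_iff, Fin.le_def] at *
      by_cases hb : (b : ℕ) = i
      · simp only [hb, lt_irrefl, if_true, if_false, Nat.lt_succ_self]
        split_ifs <;> simp <;> grind
      · by_cases hb1 : (b : ℕ) = i + 1
        · simp only [hb1]
          by_cases hc : (c : ℕ) = i + 1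
          · simp [hc]
          · grind
        · grind

theorem mat_prod_bigY {n : ℕ} {q : ℕ → ℂ} (hq : ∀ i, q i ≠ 0) (hq0 : q 0 = 1) (d : Fin n → ℂˣ)
    (hd : ∀ i : Fin n, (d i : ℂ) = q (i + 1)) :
    mat (List.ofFn fun i => bigY i (d i)).prod = stepMatrix n q := by
  have key : ∀ p ≤ n, mat ((List.ofFn fun i => bigY i (d i)).take p).prod =
      partialStepMatrix n q p := by
    intro p
    induction p with
    | zero =>
      intro _
      rw [List.take_zero, List.prod_nil, mat_one]
      ext r t
      rcases r with a | a <;> rcases t with b | b <;>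
        simp only [partialStepMatrix, Matrix.of_apply, Matrix.one_apply, Sum.inl.injEq,
          Sum.inr.injEq, Fin.ext_iff, Fin.le_def] <;> grind
    | succ p ih =>
      intro hp
      rw [List.prod_take_succ _ _ (by simpa using hp), mat_mul, ih (by omega), List.getElem_ofFn]
      exact partialStepMatrix_succ hq ⟨p, by omega⟩ _ (hd _)
  have h := key n le_rfl
  rw [List.take_of_length_le (by simp)] at h
  rw [h]
  ext r t
  rcases r with a | a <;> rcases t with b | b <;> simp [partialStepMatrix, stepMatrix]

theorem coord_ne_zero {n : ℕ} (c : Fin n → Fin n → ℂˣ) (i j : ℕ) : coord c i j ≠ 0 := by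
  unfold coord
  split_ifs
  · exact Units.ne_zero _
  · exact one_ne_zero

theorem coord_zero {n : ℕ} (c : Fin n → Fin n → ℂˣ) (j : ℕ) : coord c 0 j = 1 := by
  simp [coord]

/-- The matrix of the product of the factors of `Θ⁻(c)` with upper index greater than `p`. -/
def tailMatrix {n : ℕ} (c : Fin n → Fin n → ℂˣ) (p : ℕ) : Matrix (J n) (J n) ℂ :=
  mat ((List.ofFn fun j => (List.ofFn fun i => bigY i (c i j)).prod).drop p).prod

theorem tailMatrix_zero {n : ℕ} (c : Fin n → Fin n → ℂˣ) : tailMatrix c 0 = mat (Θ c) := rfl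

theorem tailMatrix_self {n : ℕ} (c : Fin n → Fin n → ℂˣ) : tailMatrix c n = 1 := by
  rw [tailMatrix, List.drop_of_length_le (by simp), List.prod_nil, mat_one]

theorem tailMatrix_succ {n : ℕ} (c : Fin n → Fin n → ℂˣ) {p : ℕ} (hp : p < n) :
    tailMatrix c p = stepMatrix n (fun i => coord c i (p + 1)) * tailMatrix c (p + 1) := by
  unfold tailMatrix
  rw [List.drop_eq_getElem_cons (by simpa using hp), List.prod_cons, mat_mul, List.getElem_ofFn,
    mat_prod_bigY (fun i => coord_ne_zero c i (p + 1)) (coord_zero c _)]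
  intro i
  have h : (1 ≤ (i : ℕ) + 1 ∧ (i : ℕ) + 1 ≤ n) ∧ (1 ≤ p + 1 ∧ p + 1 ≤ n) := by omega
  rw [coord, dif_pos h]
  rfl

/-- The row with one-based index `i` of `tailMatrix c p`, with `0` for the missing row of index
`0`. -/
def tailRow {n : ℕ} (c : Fin n → Fin n → ℂˣ) (p i : ℕ) (t : J n) : ℂ :=
  if h : 1 ≤ i ∧ i ≤ n then tailMatrix c p (Sum.inl ⟨i - 1, by omega⟩) t else 0

theorem tailRow_zero {n : ℕ} (c : Fin n → Fin n → ℂˣ) (p : ℕ) (t : J n) : tailRow c p 0 t = 0 := by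
  simp [tailRow]

/-- The upper half of a step matrix is lower bidiagonal with 1 below the diagonal. The convention
that row 0 is zero covers i = 0. -/
theorem tailRow_succ {n : ℕ} (c : Fin n → Fin n → ℂˣ) {p i : ℕ} (hp : p < n) (hi : i < n)
    (t : J n) : tailRow c p (i + 1) t = tailRow c (p + 1) i t +
      coord c i (p + 1) / coord c (i + 1) (p + 1) * tailRow c (p + 1) (i + 1) t := by
  have h1 : ∀ p', tailRow c p' (i + 1) t = tailMatrix c p' (Sum.inl ⟨i, hi⟩) t := by
    intro p'
    rw [tailRow, dif_pos ⟨by omega, by omega⟩]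
    rfl
  rw [h1, h1, tailMatrix_succ c hp, Matrix.mul_apply, Fintype.sum_sum_type]
  have h2 : ∑ b : Fin n, stepMatrix n (fun i => coord c i (p + 1)) (Sum.inl ⟨i, hi⟩) (Sum.inr b) *
      tailMatrix c (p + 1) (Sum.inr b) t = 0 := by simp [stepMatrix]
  rw [h2, add_zero]
  have h3 : ∀ b : Fin n, stepMatrix n (fun i => coord c i (p + 1)) (Sum.inl ⟨i, hi⟩) (Sum.inl b) *
      tailMatrix c (p + 1) (Sum.inl b) t =
      (if i = b + 1 then tailMatrix c (p + 1) (Sum.inl b) t else 0) +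
      (if ⟨i, hi⟩ = b then coord c i (p + 1) / coord c (i + 1) (p + 1) *
        tailMatrix c (p + 1) (Sum.inl b) t else 0) := by
    intro b
    simp only [stepMatrix, Matrix.of_apply, Fin.ext_iff]
    split_ifs <;> first | omega | simp
  simp only [h3, Finset.sum_add_distrib, Finset.sum_ite_eq, Finset.mem_univ, if_true]
  congr 1
  rcases Nat.eq_zero_or_pos i with h0 | h0
  · subst h0
    simp [tailRow_zero]
  · rw [Finset.sum_eq_single ⟨i - 1, by omega⟩, tailRow, dif_pos ⟨h0, hi.le⟩, if_pos]
    · simp only; omega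
    · intro b _ hb
      rw [if_neg]
      intro h; apply hb; apply Fin.ext; simp only; omega
    · simp

/-- A product of n - p lower bidiagonal factors with subdiagonal 1 has its first nonzero entry of
row i, equal to 1, in column i - (n - p). Here `b` is column b + 1. -/
theorem tailRow_inl_of_le {n : ℕ} (c : Fin n → Fin n → ℂˣ) (b : Fin n) {p i : ℕ} (hp : p ≤ n)
    (hi : i ≤ n) (h : (b : ℕ) + 1 + n ≤ i + p) :
    tailRow c p i (Sum.inl b) = if (b : ℕ) + 1 + n = i + p then 1 else 0 := by
  obtain ⟨m, hm⟩ : ∃ m, p + m = n := ⟨n - p, by omega⟩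
  induction m generalizing p i with
  | zero =>
    obtain rfl : p = n := hm
    rw [tailRow, tailMatrix_self]
    split_ifs with h1 h2 h2
    · rw [show (⟨i - 1, by omega⟩ : Fin p) = b from Fin.ext (by simp only; omega),
        Matrix.one_apply_eq]
    · rw [Matrix.one_apply_ne]
      simp only [ne_eq, Sum.inl.injEq, Fin.ext_iff]
      omega
    · omega
    · rfl
  | succ m ih =>
    rcases Nat.eq_zero_or_pos i with h0 | h0
    · omega
    · obtain ⟨i, rfl⟩ : ∃ k, i = k + 1 := ⟨i - 1, by omega⟩
      rw [tailRow_succ c (by omega) (by omega), ih (by omega) (by omega) (by omega) (by omega),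
        ih (by omega) (by omega) (by omega) (by omega), if_neg (c := _ = i + 1 + (p + 1)) (by omega),
        mul_zero, add_zero]
      exact if_congr (by omega) rfl rfl

/-! ### The lower left block -/

/-- The columns of the lower left block of `Θ⁻(c)`, up to a unitriangular factor. -/
def blockCol (n : ℕ) (q : ℕ → ℕ → ℂ) : ℕ → ℕ → ℕ → ℂ
  | 0, p, a => 1 / q a p
  | k + 1, p, a => ∑ b ∈ Finset.Ico a n, q (b + 1) p / q a p * blockCol n q k (p + 1) b

/-- If w is the nonzero column of the lower left block of a step and D its lower right block, the
lower left block of a tail is w times the n-th row of the next tail, plus D times the lower left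
block of the next tail. Unfolding this, `blockCol` at k is a product of k matrices D applied to a
column w. -/
theorem tailMatrix_inr_inl {n : ℕ} (c : Fin n → Fin n → ℂˣ) {p m : ℕ} (hm : p + m = n)
    (a b : Fin n) : tailMatrix c p (Sum.inr a) (Sum.inl b) =
      ∑ k ∈ Finset.range m, blockCol n (coord c) k (p + 1) a * tailRow c (p + 1 + k) n (Sum.inl b) := by
  induction m generalizing p a with
  | zero =>
    obtain rfl : p = n := hm
    simp [tailMatrix_self]
  | succ m ih =>
    rw [tailMatrix_succ c (by omega), Matrix.mul_apply, Fintype.sum_sum_type,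
      Finset.sum_range_succ', add_comm]
    congr 1
    · have h1 : ∀ b' : Fin n, stepMatrix n (fun i => coord c i (p + 1)) (Sum.inr a) (Sum.inr b') *
          tailMatrix c (p + 1) (Sum.inr b') (Sum.inl b) = if (a : ℕ) ≤ b' then
            coord c (b' + 1) (p + 1) / coord c a (p + 1) *
            ∑ k ∈ Finset.range m, blockCol n (coord c) k (p + 1 + 1) b' *
              tailRow c (p + 1 + 1 + k) n (Sum.inl b) else 0 := by
        intro b'
        rw [ih (by omega)]
        simp only [stepMatrix, Matrix.of_apply, Fin.le_def, ite_mul, zero_mul]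
      simp only [h1]
      rw [Fin.sum_univ_eq_sum_range (fun b' => if (a : ℕ) ≤ b' then
            coord c (b' + 1) (p + 1) / coord c a (p + 1) *
            ∑ k ∈ Finset.range m, blockCol n (coord c) k (p + 1 + 1) b' *
              tailRow c (p + 1 + 1 + k) n (Sum.inl b) else 0) n, ← Finset.sum_filter]
      have h2 : (Finset.range n).filter (fun b' => (a : ℕ) ≤ b') = Finset.Ico (a : ℕ) n := by
        ext k; simp [and_comm]
      rw [h2]
      simp only [blockCol, Finset.sum_mul, Finset.mul_sum]
      rw [Finset.sum_comm]
      refine Finset.sum_congr rfl fun k _ => Finset.sum_congr rfl fun b' _ => ?_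
      rw [show p + 1 + (k + 1) = p + 1 + 1 + k by ring]
      ring
    · have hn : 0 < n := by omega
      rw [Finset.sum_eq_single ⟨n - 1, by omega⟩]
      · rw [tailRow, dif_pos ⟨hn, le_rfl⟩]
        simp only [stepMatrix, Matrix.of_apply, blockCol, add_zero]
        rw [if_pos (by omega)]
      · intro b' _ hb'
        simp only [stepMatrix, Matrix.of_apply]
        rw [if_neg, zero_mul]
        intro h; apply hb'; apply Fin.ext; simp only; omega
      · simp

/-- The entries of the lower unitriangular factor of the lower left block. -/
def lowEntry (q : ℕ → ℕ → ℂ) : ℕ → ℕ → ℕ → ℂ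
  | 0, p, a => 1 / q a p
  | N + 1, p, a => (∑ b ∈ Finset.range a, q (b + 1) p * lowEntry q N (p + 1) b) / q a p

/-- The entries, up to sign, of the inverse of the upper triangular factor of the lower left
block. -/
def upEntry (n : ℕ) (q : ℕ → ℕ → ℂ) : ℕ → ℕ → ℂ
  | 0, _ => 1
  | N + 1, p => ∑ b ∈ Finset.range n, q (b + 1) p * lowEntry q N (p + 1) b

/-- The lower right block is the rank one matrix q_{b+1}/q_a minus its strictly lower part. The rank
one matrix maps every vector to a multiple of the column 1/q_a, and `upEntry` is this multiple. The
term k = 0 therefore cancels it, and each level leaves only a strictly lower triangular matrix. -/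
theorem sum_blockCol_mul_upEntry {n : ℕ} (q : ℕ → ℕ → ℂ) (N p : ℕ) {a : ℕ} (ha : a ≤ n) :
    ∑ k ∈ Finset.range (N + 1), blockCol n q k p a * ((-1) ^ k * upEntry n q (N - k) (p + k)) =
      lowEntry q N p a := by
  induction N generalizing p a with
  | zero => simp [blockCol, upEntry, lowEntry]
  | succ N ih =>
    rw [Finset.sum_range_succ']
    have h1 : ∑ k ∈ Finset.range (N + 1), blockCol n q (k + 1) p a *
        ((-1) ^ (k + 1) * upEntry n q (N + 1 - (k + 1)) (p + (k + 1))) =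
        -∑ b ∈ Finset.Ico a n, q (b + 1) p / q a p * lowEntry q N (p + 1) b := by
      have h2 : ∀ b ∈ Finset.Ico a n, q (b + 1) p / q a p * lowEntry q N (p + 1) b =
          ∑ k ∈ Finset.range (N + 1), q (b + 1) p / q a p * (blockCol n q k (p + 1) b *
            ((-1) ^ k * upEntry n q (N - k) (p + 1 + k))) := by
        intro b hb
        rw [← ih (p + 1) (Finset.mem_Ico.mp hb).2.le, Finset.mul_sum]
      rw [Finset.sum_congr rfl h2, Finset.sum_comm, ← Finset.sum_neg_distrib]
      refine Finset.sum_congr rfl fun k _ => ?_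
      rw [blockCol, Finset.sum_mul, ← Finset.sum_neg_distrib]
      refine Finset.sum_congr rfl fun b _ => ?_
      rw [show p + (k + 1) = p + 1 + k by ring, show N + 1 - (k + 1) = N - k by omega]
      ring
    rw [h1]
    simp only [blockCol, upEntry, lowEntry, pow_zero, Nat.sub_zero, add_zero, one_mul]
    have h3 := Finset.sum_range_add_sum_Ico (fun b => q (b + 1) p * lowEntry q N (p + 1) b) ha
    rw [← h3]
    have h4 : ∑ b ∈ Finset.Ico a n, q (b + 1) p / q a p * lowEntry q N (p + 1) b =
        (∑ b ∈ Finset.Ico a n, q (b + 1) p * lowEntry q N (p + 1) b) / q a p := by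
      rw [Finset.sum_div]
      exact Finset.sum_congr rfl fun b _ => by ring
    rw [h4]
    ring

/-- Each level applies a strictly lower triangular matrix, which pushes the support down by one. -/
theorem lowEntry_of_lt (q : ℕ → ℕ → ℂ) {N a : ℕ} (p : ℕ) (h : a < N) : lowEntry q N p a = 0 := by
  induction N generalizing p a with
  | zero => omega
  | succ N ih =>
    rw [lowEntry, Finset.sum_eq_zero, zero_div]
    intro b hb
    rw [Finset.mem_range] at hb
    rw [ih _ (by omega), mul_zero]

theorem lowEntry_self {q : ℕ → ℕ → ℂ} (hq : ∀ i j, q i j ≠ 0) (hq0 : ∀ j, q 0 j = 1) (N p : ℕ) :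
    lowEntry q N p N = 1 := by
  induction N generalizing p with
  | zero => simp [lowEntry, hq0]
  | succ N ih =>
    rw [lowEntry, Finset.sum_range_succ, Finset.sum_eq_zero, ih, zero_add, mul_one,
      div_self (hq _ _)]
    intro b hb
    rw [lowEntry_of_lt _ _ (Finset.mem_range.mp hb), mul_zero]

/-- In the recursion only the last two summands survive: the unit diagonal entry contributes a new
quotient, and the other one is the same expression one level down. -/
theorem lowEntry_succ {q : ℕ → ℕ → ℂ} (hq : ∀ i j, q i j ≠ 0) (hq0 : ∀ j, q 0 j = 1) (N p : ℕ) :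
    lowEntry q N p (N + 1) = 1 / q 1 (p + N) +
      ∑ j ∈ Finset.range N, q (N - j) (p + j) / q (N - j + 1) (p + j) := by
  induction N generalizing p with
  | zero => simp [lowEntry]
  | succ N ih =>
    rw [lowEntry, Finset.sum_range_succ, Finset.sum_range_succ, Finset.sum_eq_zero, ih,
      lowEntry_self hq hq0, Finset.sum_range_succ' _ N]
    · have h1 := hq (N + 1 + 1) p
      have h2 : ∑ j ∈ Finset.range N, q (N + 1 - (j + 1)) (p + (j + 1)) /
          q (N + 1 - (j + 1) + 1) (p + (j + 1)) =
          ∑ j ∈ Finset.range N, q (N - j) (p + 1 + j) / q (N - j + 1) (p + 1 + j) := by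
        refine Finset.sum_congr rfl fun j _ => ?_
        rw [show p + (j + 1) = p + 1 + j by ring, show N + 1 - (j + 1) = N - j by omega]
      rw [h2, show p + (N + 1) = p + 1 + N by ring]
      simp only [Nat.sub_zero, add_zero]
      field_simp
      ring
    · intro b hb
      rw [lowEntry_of_lt _ _ (Finset.mem_range.mp hb), mul_zero]

/-! ### Sums over increasing sequences -/

/-- The sum over all sequences `1 ≤ u_1 < ⋯ < u_m ≤ n` of the products of the `g (u_b) b`. -/
def increasingSum (g : ℕ → ℕ → ℂ) (n m : ℕ) : ℂ := ∑ u ∈ increasing n m, ∏ b : Fin m, g (u b) b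

theorem mem_increasing {n m : ℕ} {u : Fin m → ℕ} :
    u ∈ increasing n m ↔ (∀ b, 1 ≤ u b ∧ u b ≤ n) ∧ StrictMono u := by
  simp [increasing]

theorem increasingSum_zero (g : ℕ → ℕ → ℂ) (n : ℕ) : increasingSum g n 0 = 1 := by
  have : increasing n 0 = {Fin.elim0} := by
    ext u
    rw [mem_increasing, Finset.mem_singleton]
    exact ⟨fun _ => Subsingleton.elim _ _, fun _ => ⟨fun b => b.elim0, fun b => b.elim0⟩⟩
  simp [increasingSum, this]

/-- The sum is split by the largest term b + 1; the second argument of g is the zero-based position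
in the sequence. -/
theorem increasingSum_succ_right (g : ℕ → ℕ → ℂ) (n m : ℕ) : increasingSum g n (m + 1) =
    ∑ b ∈ Finset.range n, g (b + 1) m * increasingSum g b m := by
  simp only [increasingSum, Finset.mul_sum]
  rw [Finset.sum_sigma']
  symm
  refine Finset.sum_bij' (fun s _ => (Fin.snoc s.2 (s.1 + 1) : Fin (m + 1) → ℕ))
    (fun u _ => ⟨u (Fin.last m) - 1, Fin.init u⟩) ?_ ?_ ?_ ?_ ?_
  · rintro ⟨b, u⟩ h
    rw [Finset.mem_sigma, Finset.mem_range, mem_increasing] at h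
    obtain ⟨hb, hu, hm⟩ := h
    simp only at hb hu hm ⊢
    rw [mem_increasing]
    refine ⟨?_, ?_⟩
    · intro k
      refine Fin.lastCases ?_ (fun k => ?_) k
      · rw [Fin.snoc_last]; omega
      · rw [Fin.snoc_castSucc]; have := hu k; omega
    · intro k l
      refine Fin.lastCases ?_ (fun k => ?_) k <;> refine Fin.lastCases ?_ (fun l => ?_) l
      · intro h; exact absurd h (lt_irrefl _)
      · intro h; exact absurd h (Fin.castSucc_lt_last l).not_gt
      · intro _
        rw [Fin.snoc_last, Fin.snoc_castSucc]
        have := hu k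
        omega
      · intro h
        rw [Fin.snoc_castSucc, Fin.snoc_castSucc]
        exact hm h
  · intro u hu
    rw [mem_increasing] at hu
    rw [Finset.mem_sigma, Finset.mem_range, mem_increasing]
    have h1 := hu.1 (Fin.last m)
    refine ⟨by simp only; omega, fun k => ?_, fun k l h => hu.2 (by simpa using h)⟩
    have h2 := hu.1 k.castSucc
    have h3 := hu.2 (Fin.castSucc_lt_last k)
    simp only [Fin.init]
    omega
  · rintro ⟨b, u⟩ _
    simp
  · intro u hu
    rw [mem_increasing] at hu
    have h1 := hu.1 (Fin.last m)
    simp only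
    rw [Nat.sub_add_cancel h1.1, Fin.snoc_init_self]
  · rintro ⟨b, u⟩ _
    rw [Fin.prod_univ_castSucc]
    simp [mul_comm]

theorem increasingSum_succ_succ (g : ℕ → ℕ → ℂ) (n m : ℕ) : increasingSum g (n + 1) (m + 1) =
    increasingSum g n (m + 1) + g (n + 1) m * increasingSum g n m := by
  rw [increasingSum_succ_right, Finset.sum_range_succ, ← increasingSum_succ_right]

theorem increasingSum_of_lt (g : ℕ → ℕ → ℂ) {n m : ℕ} (h : n < m) : increasingSum g n m = 0 := by
  induction m generalizing n with
  | zero => omega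
  | succ m ih =>
    rw [increasingSum_succ_right]
    refine Finset.sum_eq_zero fun b hb => ?_
    rw [ih (by rw [Finset.mem_range] at hb; omega), mul_zero]

/-- Here g i b is C_i^{(b+1)}. Its denominator is the one left over from the level below, and its
numerator is the factor in the recursion, which chooses the largest term of the sequence first. -/
theorem lowEntry_eq_increasingSum {n : ℕ} (q g : ℕ → ℕ → ℂ)
    (hg : ∀ i b, g (i + 1) b = q (i + 1) (n - (b + 1)) / q i (n - (b + 1) + 1)) {m p : ℕ}
    (hmp : p + m = n) (a : ℕ) : lowEntry q m p a = increasingSum g a m / q a p := by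
  induction m generalizing p a with
  | zero => simp [lowEntry, increasingSum_zero]
  | succ m ih =>
    rw [lowEntry, increasingSum_succ_right]
    congr 1
    refine Finset.sum_congr rfl fun b _ => ?_
    rw [ih (by omega), hg, show n - (m + 1) = p by omega]
    ring

theorem upEntry_eq_increasingSum {n : ℕ} (q g : ℕ → ℕ → ℂ)
    (hg : ∀ i b, g (i + 1) b = q (i + 1) (n - (b + 1)) / q i (n - (b + 1) + 1)) {m p : ℕ}
    (hmp : p + m = n) : upEntry n q m p = increasingSum g n m := by
  cases m with
  | zero => simp [upEntry, increasingSum_zero]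
  | succ m =>
    rw [upEntry, increasingSum_succ_right]
    refine Finset.sum_congr rfl fun b _ => ?_
    rw [lowEntry_eq_increasingSum q g hg (by omega), hg, show n - (m + 1) = p by omega]
    ring

/-- A linear relation between rows of the partial products of `Θ⁻(c)`. -/
theorem sum_increasingSum_mul_tailRow {n : ℕ} (c : Fin n → Fin n → ℂˣ) (g : ℕ → ℕ → ℂ)
    (hg : ∀ i b, g (i + 1) b = coord c i (n - (i - b)) / coord c (i + 1) (n - (i - b)))
    {i : ℕ} (hi : i ≤ n) (t : J n) :
    ∑ k ∈ Finset.range (i + 1), (-1) ^ k * increasingSum g i k * tailRow c (n - i + k) i t = 0 := by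
  induction i with
  | zero => simp [tailRow_zero]
  | succ i ih =>
    rw [Finset.sum_range_succ']
    -- The sequences are split by whether they contain i + 1. By `tailRow_succ`, the k-th term
    -- without i + 1 combines with the (k+1)-st term with i + 1 to a multiple of row i of the next
    -- tail, which reduces the relation to the one for i.
    have h1 : ∀ k, (-1 : ℂ) ^ (k + 1) * increasingSum g (i + 1) (k + 1) *
        tailRow c (n - (i + 1) + (k + 1)) (i + 1) t =
        (-1) ^ (k + 1) * increasingSum g i (k + 1) * tailRow c (n - (i + 1) + (k + 1)) (i + 1) t +
        (-1) ^ (k + 1) * g (i + 1) k * increasingSum g i k *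
          tailRow c (n - (i + 1) + (k + 1)) (i + 1) t := by
      intro k
      rw [increasingSum_succ_succ]
      ring
    simp only [h1, Finset.sum_add_distrib]
    have h2 : increasingSum g (i + 1) 0 = increasingSum g i 0 := by
      rw [increasingSum_zero, increasingSum_zero]
    rw [h2, add_right_comm, ← Finset.sum_range_succ' (fun k => (-1 : ℂ) ^ k * increasingSum g i k *
      tailRow c (n - (i + 1) + k) (i + 1) t), Finset.sum_range_succ, increasingSum_of_lt g
      (Nat.lt_succ_self i), mul_zero, zero_mul, add_zero, ← Finset.sum_add_distrib,
      ← ih (by omega)]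
    refine Finset.sum_congr rfl fun k hk => ?_
    rw [Finset.mem_range] at hk
    rw [tailRow_succ c (p := n - (i + 1) + k) (by omega) (by omega), hg,
      show n - (i + 1) + k + 1 = n - (i - k) by omega,
      show n - (i + 1) + (k + 1) = n - (i - k) by omega, show n - i + k = n - (i - k) by omega]
    ring

/-! ### The evaluation of the minors -/

/-- Here W = V R with R upper unitriangular, and the column change K is upper triangular with
diagonal (-1)^q. Its determinant is the sign on the left. -/
theorem det_mul_prod_neg_one {n k : ℕ} (hk : k ≤ n) (c : Fin n → Fin n → ℂˣ)
    (W : Matrix (Fin k) (Fin k) ℂ) (v : Fin k → ℕ → ℂ)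
    (hW : ∀ a b, W a b = ∑ q ∈ Finset.range n, v a q * tailRow c (1 + q) n (emb hk b)) :
    (∏ a : Fin k, (-1 : ℂ) ^ (a : ℕ)) * W.det = (Matrix.of fun a N : Fin k =>
      ∑ q ∈ Finset.range ((N : ℕ) + 1),
        v a q * ((-1) ^ q * upEntry n (coord c) (N - q) (1 + q))).det := by
  let V : Matrix (Fin k) (Fin k) ℂ := Matrix.of fun a q => v a q
  let R : Matrix (Fin k) (Fin k) ℂ := Matrix.of fun q b => tailRow c (1 + q) n (emb hk b)
  let K : Matrix (Fin k) (Fin k) ℂ := Matrix.of fun q N =>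
    if (q : ℕ) ≤ N then (-1) ^ (q : ℕ) * upEntry n (coord c) (N - q) (1 + q) else 0
  have hR : ∀ (b : Fin k) (q : ℕ), (b : ℕ) ≤ q → q < n →
      tailRow c (1 + q) n (emb hk b) = if (b : ℕ) = q then 1 else 0 := by
    intro b q hbq hq
    rw [emb, tailRow_inl_of_le c _ (by omega) le_rfl (by simp only [Fin.val_castLE]; omega)]
    exact if_congr (by simp only [Fin.val_castLE]; omega) rfl rfl
  have hWVR : W = V * R := by
    ext a b
    rw [hW, Matrix.mul_apply]
    simp only [V, R, Matrix.of_apply]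
    rw [Fin.sum_univ_eq_sum_range (fun q => v a q * tailRow c (1 + q) n (emb hk b)) k]
    symm
    -- The terms with q ≥ k drop out, since the first k entries of those rows vanish.
    apply Finset.sum_subset (Finset.range_subset_range.mpr hk)
    intro q hq hq'
    rw [Finset.mem_range] at hq hq'
    rw [hR b q (by omega) hq, if_neg (by omega), mul_zero]
  have hRdet : R.det = 1 := by
    rw [Matrix.det_of_isUpperTriangular (M := R)]
    · refine Finset.prod_eq_one fun a _ => ?_
      simp only [R, Matrix.of_apply]
      rw [hR a a le_rfl (by omega), if_pos rfl]
    · intro a b hab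
      have hab' : (b : ℕ) < a := hab
      simp only [R, Matrix.of_apply]
      rw [hR b a hab'.le (by omega), if_neg (by omega)]
  have hKdet : K.det = ∏ a : Fin k, (-1 : ℂ) ^ (a : ℕ) := by
    rw [Matrix.det_of_isUpperTriangular (M := K)]
    · refine Finset.prod_congr rfl fun a _ => ?_
      simp [K, upEntry]
    · intro a b hab
      have hab' : (b : ℕ) < a := hab
      simp only [K, Matrix.of_apply]
      rw [if_neg (by omega)]
  rw [hWVR, Matrix.det_mul, hRdet, mul_one, ← hKdet, mul_comm, ← Matrix.det_mul]
  congr 1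
  ext a N
  rw [Matrix.mul_apply]
  simp only [V, K, Matrix.of_apply]
  rw [Fin.sum_univ_eq_sum_range (fun q => v a q * if q ≤ (N : ℕ) then
    (-1) ^ q * upEntry n (coord c) (N - q) (1 + q) else 0) k]
  symm
  rw [← Finset.sum_subset (Finset.range_subset_range.mpr (show (N : ℕ) + 1 ≤ k by omega))]
  · refine Finset.sum_congr rfl fun q hq => ?_
    rw [Finset.mem_range] at hq
    rw [if_pos (by omega)]
  · intro q _ hq
    rw [Finset.mem_range] at hq
    rw [if_neg (by omega), mul_zero]

theorem seqSign_of_strictAnti {n k : ℕ} {ρ : Fin k → J n}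
    (h : ∀ a b, b < a → rank (ρ a) < rank (ρ b)) :
    seqSign ρ = ∏ a : Fin k, (-1 : ℂ) ^ (a : ℕ) := by
  refine Finset.prod_congr rfl fun a _ => ?_
  rw [Finset.prod_congr rfl (g := fun _ => (-1 : ℂ)), Finset.prod_const, Fin.card_Iio]
  intro b hb
  rw [ordSign, if_pos (h a b (Finset.mem_Iio.mp hb))]

theorem injective_of_rank_strictAnti {n k : ℕ} {ρ : Fin k → J n}
    (h : ∀ a b, b < a → rank (ρ a) < rank (ρ b)) : Function.Injective ρ := by
  intro a b hab
  rcases lt_trichotomy a b with h1 | h1 | h1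
  · have := h b a h1; rw [hab] at this; omega
  · exact h1
  · have := h a b h1; rw [hab] at this; omega

/-- The rows of the minor `Δ_{w₀ s_k Λ_k, Λ_k}`. -/
def minorRows {n k : ℕ} (hk : 1 ≤ k) (hkn : k ≤ n) (a : Fin k) : J n :=
  bar (reflPerm (node n k hk hkn) (emb hkn a))

theorem minorRows_of_lt {n k : ℕ} (hk : 1 ≤ k) (hkn : k ≤ n) {a : Fin k} (ha : (a : ℕ) + 1 < k) :
    minorRows hk hkn a = Sum.inr (Fin.castLE hkn a) := by
  apply rank_injective
  have h : (node n k hk hkn : ℕ) = k - 1 := rfl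
  rw [minorRows, rank_bar, rank_reflPerm, rank_emb, rank_inr, Fin.val_castLE]
  rw [if_neg (by omega), if_neg (by omega), if_neg (by omega), if_neg (by omega)]

/-- This row is the bar of k + 1 for k < n, but n for k = n, where it leaves the lower half of the
matrix. Hence the two different formulas. -/
theorem minorRows_last {n k : ℕ} (hk : 1 ≤ k) (hkn : k ≤ n) {a : Fin k} (ha : (a : ℕ) + 1 = k) :
    minorRows hk hkn a = bar (up (node n k hk hkn)) := by
  rw [minorRows, ← reflPerm_inl]
  congr 2
  apply rank_injective
  rw [rank_emb, rank_inl]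
  simp only [node]
  omega

theorem rank_minorRows_lt {n k : ℕ} (hk : 1 ≤ k) (hkn : k ≤ n) (a b : Fin k) (h : b < a) :
    rank (minorRows hk hkn a) < rank (minorRows hk hkn b) := by
  rw [Fin.lt_def] at h
  rw [minorRows_of_lt hk hkn (a := b) (by omega), rank_inr]
  by_cases ha : (a : ℕ) + 1 = k
  · rw [minorRows_last hk hkn ha, rank_bar, rank_up]
    simp only [node, Fin.val_castLE]
    omega
  · rw [minorRows_of_lt hk hkn (a := a) (by omega), rank_inr]
    simp only [Fin.val_castLE]
    omega

/-- As w₀ = -1, the weight w₀ s_k Λ_k is the sum of the weights of the barred indices s_k(1), …,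
s_k(k). Listed in this way the rows have decreasing rank, so every pair is an inversion. -/
theorem generalizedMinor_w₀_s {n k : ℕ} (hk : 1 ≤ k) (hkn : k ≤ n) (c : Fin n → Fin n → ℂˣ) :
    generalizedMinor (fundWeight (node n k hk hkn))
        ((w₀ n * s (node n k hk hkn) : Weight n ≃ₗ[ℤ] Weight n) (fundWeight (node n k hk hkn)))
        (fundWeight (node n k hk hkn)) (Θ c) =
      (∏ a : Fin k, (-1 : ℂ) ^ (a : ℕ)) *
        ((mat (Θ c)).submatrix (minorRows hk hkn) (emb hkn)).det := by
  have hanti := rank_minorRows_lt hk hkn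
  rw [← seqSign_of_strictAnti hanti]
  refine generalizedMinor_eq hk hkn ⟨w₀ n * s (node n k hk hkn), rfl⟩
    (injective_of_rank_strictAnti hanti) ?_ ?_ (joinedToTorus_Θ c)
  · intro a b
    simp only [minorRows, ← reflPerm_bar]
    rw [(Equiv.injective _).ne_iff, bar_injective.ne_iff]
    simp [emb, bar]
  · show _ = (w₀ n : Weight n ≃ₗ[ℤ] Weight n) (reflection _ _)
    rw [w₀_apply, sum_wt_emb, ← Finset.sum_neg_distrib]
    refine Finset.sum_congr rfl fun a _ => ?_
    rw [minorRows, wt_bar, wt_reflPerm]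

/-- Triangularity puts no condition on the last row, and the other diagonal entries are 1, so only
the corner entry is left. -/
theorem det_of_lowEntry_rows {n k : ℕ} (hk : 1 ≤ k) (c : Fin n → Fin n → ℂˣ)
    (M : Matrix (Fin k) (Fin k) ℂ)
    (hM : ∀ a N : Fin k, (a : ℕ) + 1 < k → M a N = lowEntry (coord c) N 1 a) :
    M.det = M ⟨k - 1, by omega⟩ ⟨k - 1, by omega⟩ := by
  rw [Matrix.det_of_isLowerTriangular M, Finset.prod_eq_single ⟨k - 1, by omega⟩]
  · intro a _ ha
    have : (a : ℕ) ≠ k - 1 := fun h => ha (Fin.ext h)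
    rw [hM a a (by omega), lowEntry_self (coord_ne_zero c) (coord_zero c)]
  · simp
  · intro a b hab
    have hab' : (a : ℕ) < b := hab
    rw [hM a b (by omega), lowEntry_of_lt _ _ hab']

theorem mat_Θ_inr {n k : ℕ} (hk : k ≤ n) (c : Fin n → Fin n → ℂˣ) (a : Fin n) (b : Fin k) :
    mat (Θ c) (Sum.inr a) (emb hk b) = ∑ q ∈ Finset.range n,
      blockCol n (coord c) q 1 a * tailRow c (1 + q) n (emb hk b) := by
  rw [← tailMatrix_zero, emb, tailMatrix_inr_inl c (Nat.zero_add n)]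

theorem generalizedMinor_of_lt {n k : ℕ} (hk : 1 ≤ k) (hkn : k < n) (c : Fin n → Fin n → ℂˣ) :
    generalizedMinor (fundWeight (node n k hk hkn.le))
        ((w₀ n * s (node n k hk hkn.le) : Weight n ≃ₗ[ℤ] Weight n)
          (fundWeight (node n k hk hkn.le)))
        (fundWeight (node n k hk hkn.le)) (Θ c) =
      1 / coord c 1 k + ∑ j ∈ Finset.Icc 1 (k - 1), coord c (k - j) j / coord c (k - j + 1) j := by
  let row : Fin k → Fin n := fun a => if (a : ℕ) + 1 < k then Fin.castLE hkn.le a else ⟨k, hkn⟩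
  have hrow : ∀ a, minorRows hk hkn.le a = Sum.inr (row a) := by
    intro a
    simp only [row]
    split_ifs with h
    · exact minorRows_of_lt hk hkn.le h
    · rw [minorRows_last hk hkn.le (by omega)]
      apply rank_injective
      rw [rank_bar, rank_up, rank_inr]
      simp only [node]
      omega
  rw [generalizedMinor_w₀_s, det_mul_prod_neg_one hkn.le c _
    (fun a q => blockCol n (coord c) q 1 (row a))
    (fun a b => by rw [Matrix.submatrix_apply, hrow, mat_Θ_inr]),
    det_of_lowEntry_rows hk c]
  · simp only [Matrix.of_apply]
    rw [sum_blockCol_mul_upEntry _ _ _ (row _).2.le]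
    have h1 : (row ⟨k - 1, by omega⟩ : ℕ) = k - 1 + 1 := by
      simp only [row]; rw [if_neg (by omega)]; simp only; omega
    rw [h1, lowEntry_succ (coord_ne_zero c) (coord_zero c), show 1 + (k - 1) = k by omega]
    congr 1
    rw [← Finset.Ico_succ_right_eq_Icc, Finset.sum_Ico_eq_sum_range]
    refine Finset.sum_congr (by simp) fun j _ => ?_
    rw [show k - (1 + j) = k - 1 - j by omega]
  · intro a N ha
    simp only [Matrix.of_apply]
    rw [sum_blockCol_mul_upEntry _ _ _ (row _).2.le]
    simp only [row]
    rw [if_pos ha]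
    rfl

theorem generalizedMinor_last {n : ℕ} (hn : 1 ≤ n) (c : Fin n → Fin n → ℂˣ) :
    generalizedMinor (fundWeight (node n n hn le_rfl))
        ((w₀ n * s (node n n hn le_rfl) : Weight n ≃ₗ[ℤ] Weight n)
          (fundWeight (node n n hn le_rfl)))
        (fundWeight (node n n hn le_rfl)) (Θ c) =
      ∑ m ∈ Finset.range n,
        ∑ u ∈ increasing n m, ∑ l ∈ increasing n (n - m),
          (∏ b : Fin m, monC c (u b) ((b : ℕ) + 1)) *
            ∏ a : Fin (n - m), monCbar c (l a) (l a - ((a : ℕ) + 1)) := by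
  let g : ℕ → ℕ → ℂ := fun i b => monC c i (b + 1)
  -- The truncated subtraction is harmless: the term at zero-based position b of an increasing
  -- sequence of positive integers is at least b + 1.
  let g' : ℕ → ℕ → ℂ := fun i b => monCbar c i (i - (b + 1))
  have hg : ∀ i b, g (i + 1) b =
      coord c (i + 1) (n - (b + 1)) / coord c i (n - (b + 1) + 1) := fun i b => rfl
  have hg' : ∀ i b, g' (i + 1) b =
      coord c i (n - (i - b)) / coord c (i + 1) (n - (i - b)) := by
    intro i b
    simp only [g', monCbar, Nat.add_sub_add_right, Nat.add_sub_cancel]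
  -- Row n of Θ⁻(c) lies outside the lower left block, but the relation for i = n writes it through
  -- the same rows of R, so the factorization V R extends to it.
  have hlast : ∀ t, mat (Θ c) (Sum.inl ⟨n - 1, by omega⟩) t = ∑ q ∈ Finset.range n,
      (-1) ^ q * increasingSum g' n (q + 1) * tailRow c (1 + q) n t := by
    intro t
    have h := sum_increasingSum_mul_tailRow c g' hg' le_rfl t
    rw [Finset.sum_range_succ', increasingSum_zero, Nat.sub_self, pow_zero, one_mul, one_mul] at h
    have h1 : tailRow c (0 + 0) n t = mat (Θ c) (Sum.inl ⟨n - 1, by omega⟩) t := by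
      rw [tailRow, dif_pos ⟨hn, le_rfl⟩, ← tailMatrix_zero]
    rw [h1] at h
    rw [eq_neg_of_add_eq_zero_right h, ← Finset.sum_neg_distrib]
    refine Finset.sum_congr rfl fun q _ => ?_
    rw [zero_add, add_comm q 1]
    ring
  let v : Fin n → ℕ → ℂ := fun a q => if (a : ℕ) + 1 < n then blockCol n (coord c) q 1 a
    else (-1) ^ q * increasingSum g' n (q + 1)
  rw [generalizedMinor_w₀_s, det_mul_prod_neg_one le_rfl c _ v ?_, det_of_lowEntry_rows hn c]
  · simp only [Matrix.of_apply, v]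
    rw [Nat.sub_add_cancel hn]
    simp only [lt_irrefl, if_false]
    -- After the substitution q = n - 1 - m, the index m is the length of the sequence u and q + 1 =
    -- n - m that of l.
    rw [← Finset.sum_range_reflect]
    refine Finset.sum_congr rfl fun m hm => ?_
    rw [Finset.mem_range] at hm
    rw [show n - 1 - (n - 1 - m) = m by omega, show n - 1 - m + 1 = n - m by omega,
      show 1 + (n - 1 - m) = n - m by omega, upEntry_eq_increasingSum (coord c) g hg (by omega),
      ← Finset.sum_mul_sum]
    have h1 : (-1 : ℂ) ^ (n - 1 - m) * (-1) ^ (n - 1 - m) = 1 := by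
      rw [← mul_pow]; simp
    change _ = increasingSum g n m * increasingSum g' n (n - m)
    linear_combination (increasingSum g n m * increasingSum g' n (n - m)) * h1
  · intro a N ha
    simp only [Matrix.of_apply, v, ha, if_true]
    exact sum_blockCol_mul_upEntry _ _ _ a.2.le
  · intro a b
    rw [Matrix.submatrix_apply]
    simp only [v]
    split_ifs with h
    · rw [minorRows_of_lt hn le_rfl h, mat_Θ_inr]
      rfl
    · rw [minorRows_last hn le_rfl (by omega), ← hlast]
      congr 1
      apply rank_injective
      rw [rank_bar, rank_up, rank_inl]
      simp only [node]
      omega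

end TypeC

end

theorem mainTheorem2 (n : ℕ) (hn : 1 ≤ n) (c : Fin n → Fin n → ℂˣ) :
    (∀ (k : ℕ) (hk : 1 ≤ k) (hkn : k < n),
      TypeC.generalizedMinor (TypeC.fundWeight (TypeC.node n k hk hkn.le))
          ((TypeC.w₀ n * TypeC.s (TypeC.node n k hk hkn.le) :
              TypeC.Weight n ≃ₗ[ℤ] TypeC.Weight n)
            (TypeC.fundWeight (TypeC.node n k hk hkn.le)))
          (TypeC.fundWeight (TypeC.node n k hk hkn.le)) (TypeC.Θ c) =
        1 / TypeC.coord c 1 k +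
          ∑ j ∈ Finset.Icc 1 (k - 1), TypeC.coord c (k - j) j / TypeC.coord c (k - j + 1) j) ∧
    TypeC.generalizedMinor (TypeC.fundWeight (TypeC.node n n hn le_rfl))
        ((TypeC.w₀ n * TypeC.s (TypeC.node n n hn le_rfl) :
            TypeC.Weight n ≃ₗ[ℤ] TypeC.Weight n)
          (TypeC.fundWeight (TypeC.node n n hn le_rfl)))
        (TypeC.fundWeight (TypeC.node n n hn le_rfl)) (TypeC.Θ c) =
      ∑ m ∈ Finset.range n,
        ∑ u ∈ TypeC.increasing n m, ∑ l ∈ TypeC.increasing n (n - m),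
          (∏ b : Fin m, TypeC.monC c (u b) ((b : ℕ) + 1)) *
            ∏ a : Fin (n - m), TypeC.monCbar c (l a) (l a - ((a : ℕ) + 1)) :=
  ⟨fun _ hk hkn => TypeC.generalizedMinor_of_lt hk hkn c, TypeC.generalizedMinor_last hn c⟩
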